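/- Let $d\ge 1$, $p\ge 1$, and let $\mathcal T_h$ be a finite matching mesh of nondegenerate open $d$-simplices in $\mathbb R^d$: any two distinct closed elements are either disjoint or meet in a common subsimplex. Let $\Omega$ be the interior of $\bigcup_{K\in\mathcal T_h}\overline K$ (for instance, any bounded connected Lipschitz polyhedral domain partitioned by such a mesh). For an open set $\omega$, $H^1_0(\omega)$ is the closure of $C_c^\infty(\omega)$ in $H^1(\omega)$ (for Lipschitz $\omega$, the functions of zero trace). For a set $\mathcal T$ of simplices, $\mathcal P_p(\mathcal T)$ is the space of functions whose restriction to each $K\in\mathcal T$ is a polynomial of total degree at most $p$, and $\nabla_h$ is the elementwise gradient. Let $\mathcal V_h$ be the set of mesh vertices; for $a\in\mathcal V_h$ let $\mathcal T_a$ be the set of elements having $a$ as a vertex, $\omega_a$ the interior of $\bigcup_{K\in\mathcal T_a}\overline K$, and $\psi_a$ the continuous piecewise affine function with $\psi_a(b)=\delta_{a,b}$ for all $b\in\mathcal V_h$. Let $\mathcal I_h^p$ be the elementwise Lagrange interpolation of degree $p$ at the points of each $\overline K$ whose barycentric coordinates are integer multiples of $1/p$. For $u\in H^1_0(\Omega)$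 let $\pi_h^p u\in\mathcal P_p(\mathcal T_h)$ be defined on every $K\in\mathcal T_h$ by $$\int_K \pi_h^p u=\int_K u,\qquad \int_K\nabla(\pi_h^p u)\cdot\nabla q=\int_K\nabla u\cdot\nabla q\quad\text{for all polynomials } q \text{ of degree at most } p.$$ For $u_h\in\mathcal P_p(\mathcal T_a)$ let $$s_h^a(u_h):=\operatorname*{arg\,min}_{v_h\in\mathcal P_p(\mathcal T_a)\cap H^1_0(\omega_a)}\|\nabla_h(\mathcal I_h^p(\psi_a u_h)-v_h)\|_{L^2(\omega_a)},$$ extended by zero outside $\omega_a$, and set $$\mathcal J_h^p u:=\sum_{a\in\mathcal V_h}s_h^a\big((\pi_h^p u)|_{\omega_a}\big).$$ Then $\mathcal J_h^p$ maps $H^1_0(\Omega)$ into $\mathcal P_p(\mathcal T_h)\cap H^1_0(\Omega)$ and is a projector: $$\mathcal J_h^p u=u\qquad\text{for all } u\in\mathcal P_p(\mathcal T_h)\cap H^1_0(\Omega).$$ -/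

import Mathlib

open MeasureTheory Filter Topology
open scoped ContDiff

namespace ProjFE

noncomputable section

/-- The Euclidean space `ℝ^d`. -/
abbrev Pt (d : ℕ) := EuclideanSpace ℝ (Fin d)

/-- Real polynomials in `d` variables. -/
abbrev Poly (d : ℕ) := MvPolynomial (Fin d) ℝ

/-- The value of a polynomial at a point. -/
def polyVal {d : ℕ} (q : Poly d) (x : Pt d) : ℝ := MvPolynomial.eval (fun i => x i) q

/-- The pointwise inner product `∇q · ∇r` of the gradients of two polynomials. -/
def gradDot {d : ℕ} (q r : Poly d) (x : Pt d) : ℝ :=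
  ∑ i, polyVal (MvPolynomial.pderiv i q) x * polyVal (MvPolynomial.pderiv i r) x

/-! ### Sobolev spaces -/

/-- Test functions: smooth functions with compact support contained in `W`. -/
def IsTest {d : ℕ} (W : Set (Pt d)) (φ : Pt d → ℝ) : Prop :=
  ContDiff ℝ ∞ φ ∧ HasCompactSupport φ ∧ tsupport φ ⊆ W

/-- The classical partial derivative `∂φ/∂x_i`. -/
def partialDeriv {d : ℕ} (i : Fin d) (φ : Pt d → ℝ) (x : Pt d) : ℝ :=
  fderiv ℝ φ x (EuclideanSpace.single i 1)

/-- `v` belongs to `H¹(W)` and its distributional gradient is `G = (G 0, …, G (d-1))`. -/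
def HasH1Grad {d : ℕ} (W : Set (Pt d)) (v : Pt d → ℝ) (G : Fin d → Pt d → ℝ) : Prop :=
  MemLp v 2 (volume.restrict W) ∧
  (∀ i, MemLp (G i) 2 (volume.restrict W)) ∧
  ∀ φ, IsTest W φ → ∀ i,
    ∫ x in W, v x * partialDeriv i φ x = - ∫ x in W, G i x * φ x

/-- `v ∈ H¹₀(W)`, the closure of the test functions in the `H¹(W)` norm. (On a bounded Lipschitz
domain these are the functions of `H¹(W)` with vanishing trace.) -/
def MemH10 {d : ℕ} (W : Set (Pt d)) (v : Pt d → ℝ) : Prop :=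
  ∃ G : Fin d → Pt d → ℝ, HasH1Grad W v G ∧
    ∃ φ : ℕ → Pt d → ℝ, (∀ n, IsTest W (φ n)) ∧
      Tendsto (fun n => eLpNorm (fun x => v x - φ n x) 2 (volume.restrict W)) atTop (𝓝 0) ∧
      ∀ i, Tendsto (fun n => eLpNorm (fun x => G i x - partialDeriv i (φ n) x) 2
        (volume.restrict W)) atTop (𝓝 0)

/-! ### Meshes -/

/-- A finite matching simplicial mesh. An element is given by the set of its `d + 1` vertices; two
closed elements meet exactly in the (possibly empty) simplex spanned by their common vertices. -/
structure SimplicialMesh (d : ℕ) where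
  elements : Finset (Finset (Pt d))
  card_eq : ∀ K ∈ elements, K.card = d + 1
  indep : ∀ K ∈ elements, AffineIndependent ℝ ((↑) : K → Pt d)
  matching : ∀ K ∈ elements, ∀ L ∈ elements,
    convexHull ℝ (K : Set (Pt d)) ∩ convexHull ℝ (L : Set (Pt d)) =
      convexHull ℝ ((K : Set (Pt d)) ∩ (L : Set (Pt d)))

/-- The open simplex with vertex set `K`. -/
def openSimplex {d : ℕ} (K : Finset (Pt d)) : Set (Pt d) :=
  interior (convexHull ℝ (K : Set (Pt d)))

/-- The open set covered by a collection `S` of simplices: the interior of the union of the closed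
simplices. -/
def domainOf {d : ℕ} (S : Finset (Finset (Pt d))) : Set (Pt d) :=
  interior (⋃ K ∈ S, convexHull ℝ (K : Set (Pt d)))

/-- The domain `Ω` triangulated by the mesh. (A Lipschitz domain is the interior of its closure, so
that every Lipschitz domain partitioned into the mesh is recovered.) -/
def SimplicialMesh.domain {d : ℕ} (T : SimplicialMesh d) : Set (Pt d) := domainOf T.elements

open Classical in
/-- The set of vertices of the mesh. -/
def SimplicialMesh.vertices {d : ℕ} (T : SimplicialMesh d) : Finset (Pt d) :=
  T.elements.biUnion id

open Classical in
/-- The vertex patch: the elements having `a` as a vertex. -/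
def SimplicialMesh.patch {d : ℕ} (T : SimplicialMesh d) (a : Pt d) : Finset (Finset (Pt d)) :=
  T.elements.filter (fun K => a ∈ K)

/-! ### Piecewise polynomials -/

/-- The function equal to the polynomial `q K` on each open simplex `K ∈ S`, and zero elsewhere. -/
def brokenFun {d : ℕ} (S : Finset (Finset (Pt d))) (q : Finset (Pt d) → Poly d) (x : Pt d) : ℝ :=
  ∑ K ∈ S, (openSimplex K).indicator (polyVal (q K)) x

/-- `v ∈ P_p(S)`: on each simplex of `S`, `v` is a polynomial of total degree at most `p`
(functions being identified when they agree almost everywhere). -/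
def MemBroken {d : ℕ} (S : Finset (Finset (Pt d))) (p : ℕ) (v : Pt d → ℝ) : Prop :=
  ∀ K ∈ S, ∃ q : Poly d, q.totalDegree ≤ p ∧
    v =ᵐ[volume.restrict (openSimplex K)] polyVal q

/-- `v ∈ P_p(S) ∩ H¹₀(W)`, where `W` is the open set covered by `S`. -/
def MemFE {d : ℕ} (S : Finset (Finset (Pt d))) (p : ℕ) (v : Pt d → ℝ) : Prop :=
  MemBroken S p v ∧ MemH10 (domainOf S) v

/-- The norm `‖∇_h q‖` over the simplices of `S` of the elementwise gradient of a piecewise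
polynomial. -/
def brokenGradNorm {d : ℕ} (S : Finset (Finset (Pt d))) (q : Finset (Pt d) → Poly d) : ℝ :=
  Real.sqrt (∑ K ∈ S, ∫ x in openSimplex K, gradDot (q K) (q K) x)

/-! ### Hat functions and Lagrange interpolation -/

open Classical in
/-- `r` is the restriction to `K` of the hat function of the vertex `a`: the affine function that
is `1` at `a` and `0` at the other vertices (hence zero if `a` is not a vertex of `K`). -/
def IsHat {d : ℕ} (a : Pt d) (K : Finset (Pt d)) (r : Poly d) : Prop :=
  r.totalDegree ≤ 1 ∧ ∀ b ∈ K, polyVal r b = if b = a then 1 else 0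

/-- The hat function `ψ_a` on the element `K`. -/
def hat {d : ℕ} (a : Pt d) (K : Finset (Pt d)) : Poly d := Classical.epsilon (IsHat a K)

/-- The Lagrange nodes of degree `p` on the simplex `K`: the points whose barycentric coordinates
are multiples of `1 / p`. -/
def lagrangeNodes {d : ℕ} (K : Finset (Pt d)) (p : ℕ) : Set (Pt d) :=
  {x | ∃ α : Pt d → ℕ, ∑ b ∈ K, α b = p ∧ x = ∑ b ∈ K, ((α b : ℝ) / (p : ℝ)) • b}

/-- `r` is the Lagrange interpolant of degree `p` of `w` on `K`. -/
def IsLagrangeInterp {d : ℕ} (K : Finset (Pt d)) (p : ℕ) (w r : Poly d) : Prop :=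
  r.totalDegree ≤ p ∧ ∀ x ∈ lagrangeNodes K p, polyVal r x = polyVal w x

/-- The Lagrange interpolation operator `I_K^p`. -/
def lagrangeInterp {d : ℕ} (K : Finset (Pt d)) (p : ℕ) (w : Poly d) : Poly d :=
  Classical.epsilon (IsLagrangeInterp K p w)

/-! ### The quasi-interpolation operator -/

/-- `r` is the `H¹`-orthogonal projection of `v ∈ H¹(K)` onto `P_p(K)`: it has the mean value of
`v`, and `(∇r, ∇q)_K = (∇v, ∇q)_K` for all `q ∈ P_p(K)`. -/
def IsLocalBest {d : ℕ} (K : Finset (Pt d)) (p : ℕ) (v : Pt d → ℝ) (r : Poly d) : Prop :=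
  r.totalDegree ≤ p ∧
  ∫ x in openSimplex K, polyVal r x = ∫ x in openSimplex K, v x ∧
  ∃ G : Fin d → Pt d → ℝ, HasH1Grad (openSimplex K) v G ∧
    ∀ q : Poly d, q.totalDegree ≤ p →
      ∫ x in openSimplex K, gradDot r q x =
        ∫ x in openSimplex K, ∑ i, G i x * polyVal (MvPolynomial.pderiv i q) x

/-- The local-best approximation `π_K^p v`. -/
def localBest {d : ℕ} (p : ℕ) (v : Pt d → ℝ) (K : Finset (Pt d)) : Poly d :=
  Classical.epsilon (IsLocalBest K p v)

/-- The piecewise polynomial given by `s` on the simplices of `S` belongs to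
`P_p(S) ∩ H¹₀(W)`, where `W` is the open set covered by `S`. -/
def IsConforming {d : ℕ} (S : Finset (Finset (Pt d))) (p : ℕ) (s : Finset (Pt d) → Poly d) :
    Prop :=
  (∀ K ∈ S, (s K).totalDegree ≤ p) ∧ MemH10 (domainOf S) (brokenFun S s)

/-- `s` minimizes `‖∇_h (w - s)‖` over `P_p(S) ∩ H¹₀(W)`. -/
def IsConformingMin {d : ℕ} (S : Finset (Finset (Pt d))) (p : ℕ) (w s : Finset (Pt d) → Poly d) :
    Prop :=
  IsConforming S p s ∧
    ∀ v, IsConforming S p v → brokenGradNorm S (w - s) ≤ brokenGradNorm S (w - v)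

/-- The local potential reconstruction `s_h^a(q)` of a piecewise polynomial `q` in the patch of the
vertex `a`: the conforming function closest to `I_h^p (ψ_a q)`. -/
def reconstruction {d : ℕ} (T : SimplicialMesh d) (p : ℕ) (a : Pt d)
    (q : Finset (Pt d) → Poly d) : Finset (Pt d) → Poly d :=
  Classical.epsilon
    (IsConformingMin (T.patch a) p (fun K => lagrangeInterp K p (hat a K * q K)))

/-- The quasi-interpolation operator `J_h^p u = ∑_a s_h^a(π_h^p u)`, every summand being extended
by zero outside the patch of `a`. -/
def quasiInterp {d : ℕ} (T : SimplicialMesh d) (p : ℕ) (u : Pt d → ℝ) (x : Pt d) : ℝ :=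
  ∑ a ∈ T.vertices, brokenFun (T.patch a) (reconstruction T p a (localBest p u)) x

end

end ProjFE

namespace ProjFE

variable {d : ℕ}

/-! ### Polynomials as smooth functions -/

/-! Let u be a conforming piecewise polynomial. On each element u itself satisfies the conditions
defining `localBest`. Two solutions differ by a polynomial with zero gradient and zero mean, so the
local projection returns u (`localBest_eq`). The target of the minimisation on the patch of a is
then I_h^p(ψ_a u). If this target already lies in P_p ∩ H¹₀(ω_a), the minimum is zero. A conforming
function with zero elementwise gradient vanishes, so the minimiser is the target
(`reconstruction_eq`). On an element the ψ_a of its vertices sum to one, and degree-p polynomials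
are determined by their nodal values, so the targets add up to u (`sum_lagrangeInterp_hat_mul`). For
the range, each minimiser is a limit of test functions on its patch; extended by zero, it is such a
limit on Ω.

The real work is the conformity of I_h^p(ψ_a u), in `isConforming_lagrangeInterp_hat_mul`. Ω is only
the interior of a union of simplices, possibly not Lipschitz, so no trace is used. Membership in H¹₀
is translated into pointwise conditions, in both directions. Extended by zero, a broken polynomial
in H¹₀ has a bounded weak gradient on ℝ^d, hence a Lipschitz representative that vanishes off Ω
(`exists_lipschitz_of_memH10`). Conversely, a compactly supported Lipschitz function vanishing off
an open set is in H¹₀ of that set, by soft thresholding followed by mollification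
(`MemH10.of_lipschitz`).

It remains to inspect I_h^p(ψ_a u) point by point. It is single valued on common faces because the
nodes of a face determine the polynomial there (`polyVal_eq_zero_of_lagrangeNodes`). Let x be a
point of a closed patch element outside ω_a, and let σ be the face with x in its relative interior.
If a is not a vertex of σ, then ψ_a vanishes on σ. If it is, every element meeting a small
neighbourhood of x contains σ, hence a, so x is also outside Ω. Then all of σ carries u = 0, by
`mem_domain_of_mem_openFace` and continuity. In both cases all nodal values on σ are zero. -/

lemma polyVal_add (q r : Poly d) (x : Pt d) : polyVal (q + r) x = polyVal q x + polyVal r x := by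
  simp [polyVal]

lemma polyVal_sub (q r : Poly d) (x : Pt d) : polyVal (q - r) x = polyVal q x - polyVal r x := by
  simp [polyVal]

lemma polyVal_mul (q r : Poly d) (x : Pt d) : polyVal (q * r) x = polyVal q x * polyVal r x := by
  simp [polyVal]

lemma polyVal_C (c : ℝ) (x : Pt d) : polyVal (MvPolynomial.C c : Poly d) x = c := by
  simp [polyVal]

lemma polyVal_X (i : Fin d) (x : Pt d) : polyVal (MvPolynomial.X i : Poly d) x = x i := by
  simp [polyVal]

lemma polyVal_zero (x : Pt d) : polyVal (0 : Poly d) x = 0 := by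
  simp [polyVal]

lemma polyVal_smul (c : ℝ) (q : Poly d) (x : Pt d) : polyVal (c • q) x = c * polyVal q x := by
  simp [polyVal]

lemma polyVal_sum {ι : Type*} (s : Finset ι) (q : ι → Poly d) (x : Pt d) :
    polyVal (∑ i ∈ s, q i) x = ∑ i ∈ s, polyVal (q i) x := by
  simp [polyVal]

lemma polyVal_prod {ι : Type*} (s : Finset ι) (q : ι → Poly d) (x : Pt d) :
    polyVal (∏ i ∈ s, q i) x = ∏ i ∈ s, polyVal (q i) x := by
  simp [polyVal]

lemma contDiff_polyVal (q : Poly d) : ContDiff ℝ ∞ (polyVal q) := by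
  induction q using MvPolynomial.induction_on with
  | C a =>
    rw [funext (polyVal_C a)]
    exact contDiff_const
  | add p q hp hq =>
    rw [funext (polyVal_add p q)]
    exact hp.add hq
  | mul_X p i hp =>
    have : ContDiff ℝ ∞ (fun x : Pt d => x i) := (EuclideanSpace.proj (𝕜 := ℝ) i).contDiff
    have h : polyVal (p * MvPolynomial.X i) = fun x => polyVal p x * x i :=
      funext fun x => by rw [polyVal_mul, polyVal_X]
    rw [h]
    exact hp.mul this

lemma continuous_polyVal (q : Poly d) : Continuous (polyVal q) := (contDiff_polyVal q).continuous

lemma differentiableAt_polyVal (q : Poly d) (x : Pt d) : DifferentiableAt ℝ (polyVal q) x :=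
  (contDiff_polyVal q).differentiable (by simp) x

lemma partialDeriv_mul {f g : Pt d → ℝ} {x : Pt d} (i : Fin d) (hf : DifferentiableAt ℝ f x)
    (hg : DifferentiableAt ℝ g x) :
    partialDeriv i (fun y => f y * g y) x = f x * partialDeriv i g x + partialDeriv i f x * g x := by
  simp only [partialDeriv]
  rw [fderiv_fun_mul hf hg]
  simp [mul_comm]

lemma partialDeriv_polyVal (i : Fin d) (q : Poly d) (x : Pt d) :
    partialDeriv i (polyVal q) x = polyVal (MvPolynomial.pderiv i q) x := by
  induction q using MvPolynomial.induction_on with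
  | C a =>
    have : polyVal (MvPolynomial.C a : Poly d) = fun _ => a := funext fun x => polyVal_C a x
    simp [partialDeriv, this, polyVal_zero]
  | add p q hp hq =>
    have : polyVal (p + q) = polyVal p + polyVal q := funext fun x => polyVal_add p q x
    rw [map_add, polyVal_add, ← hp, ← hq]
    simp only [partialDeriv]
    rw [this, fderiv_add (differentiableAt_polyVal p x) (differentiableAt_polyVal q x)]
    simp
  | mul_X p j hp =>
    have h1 : polyVal (p * MvPolynomial.X j) = fun x => polyVal p x * x j :=
      funext fun x => by rw [polyVal_mul, polyVal_X]
    have h2 : HasFDerivAt (fun x : Pt d => x j) (EuclideanSpace.proj (𝕜 := ℝ) j) x :=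
      (EuclideanSpace.proj (𝕜 := ℝ) j).hasFDerivAt
    have h3 : partialDeriv i (fun x : Pt d => x j) x = if j = i then 1 else 0 := by
      simp only [partialDeriv]
      rw [h2.fderiv]
      simp
    rw [h1, partialDeriv_mul i (differentiableAt_polyVal p x) h2.differentiableAt, hp, h3]
    simp only [Derivation.leibniz, MvPolynomial.pderiv_X, polyVal_add, smul_eq_mul, polyVal_mul,
      polyVal_X]
    by_cases hij : j = i
    · subst hij
      simp [polyVal]
      ring
    · simp [hij, polyVal, mul_comm]

/-! ### Partial derivatives of smooth functions -/

lemma continuous_partialDeriv {f : Pt d → ℝ} (hf : ContDiff ℝ ∞ f) (i : Fin d) :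
    Continuous (partialDeriv i f) :=
  (hf.continuous_fderiv (by simp)).clm_apply continuous_const

lemma partialDeriv_eq_zero {f : Pt d → ℝ} {x : Pt d} (i : Fin d) (hx : x ∉ tsupport f) :
    partialDeriv i f x = 0 := by
  have : fderiv ℝ f x = 0 := by
    by_contra h
    exact hx (support_fderiv_subset ℝ h)
  simp [partialDeriv, this]

lemma hasCompactSupport_partialDeriv {f : Pt d → ℝ} (hf : HasCompactSupport f) (i : Fin d) :
    HasCompactSupport (partialDeriv i f) :=
  hf.mono' fun _ hx => by_contra fun h => hx (partialDeriv_eq_zero i h)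

lemma memLp_of_contDiff {f : Pt d → ℝ} (hf : Continuous f) (hc : HasCompactSupport f)
    (W : Set (Pt d)) : MemLp f 2 (volume.restrict W) :=
  (hf.memLp_of_hasCompactSupport hc).restrict W

lemma integral_mul_partialDeriv {f g : Pt d → ℝ} (hf : ContDiff ℝ ∞ f) (hg : ContDiff ℝ ∞ g)
    (hc : HasCompactSupport g) (i : Fin d) :
    ∫ x, f x * partialDeriv i g x = - ∫ x, partialDeriv i f x * g x := by
  refine integral_mul_fderiv_eq_neg_fderiv_mul_of_integrable (μ := volume)
    (v := EuclideanSpace.single i (1 : ℝ)) ?_ ?_ ?_ ?_ ?_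
  · exact ((continuous_partialDeriv hf i).mul hg.continuous).integrable_of_hasCompactSupport
      (hc.mul_left)
  · exact (hf.continuous.mul (continuous_partialDeriv hg i)).integrable_of_hasCompactSupport
      ((hasCompactSupport_partialDeriv hc i).mul_left)
  · exact (hf.continuous.mul hg.continuous).integrable_of_hasCompactSupport hc.mul_left
  · exact fun x _ => hf.differentiable (by simp) x
  · exact fun x _ => hg.differentiable (by simp) x

/-! ### Limits of test functions -/

/-- `v` is the limit in `L²(W)` of test functions whose gradients converge to `G`. -/
def H10Grad (W : Set (Pt d)) (v : Pt d → ℝ) (G : Fin d → Pt d → ℝ) : Prop :=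
  MemLp v 2 (volume.restrict W) ∧ (∀ i, MemLp (G i) 2 (volume.restrict W)) ∧
    ∃ φ : ℕ → Pt d → ℝ, (∀ n, IsTest W (φ n)) ∧
      Tendsto (fun n => eLpNorm (fun x => v x - φ n x) 2 (volume.restrict W)) atTop (𝓝 0) ∧
      ∀ i, Tendsto (fun n => eLpNorm (fun x => G i x - partialDeriv i (φ n) x) 2
        (volume.restrict W)) atTop (𝓝 0)

lemma tendsto_integral_mul {α : Type*} [MeasurableSpace α] {μ : Measure α} {v h : α → ℝ}
    {f : ℕ → α → ℝ} (hv : MemLp v 2 μ) (hf : ∀ n, MemLp (f n) 2 μ) (hh : MemLp h 2 μ)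
    (hlim : Tendsto (fun n => eLpNorm (fun x => v x - f n x) 2 μ) atTop (𝓝 0)) :
    Tendsto (fun n => ∫ x, f n x * h x ∂μ) atTop (𝓝 (∫ x, v x * h x ∂μ)) := by
  refine tendsto_integral_of_L1' (fun x => v x * h x) (hv.integrable_mul hh).1
    (Eventually.of_forall fun n => (hf n).integrable_mul hh) ?_
  have hb : ∀ n, eLpNorm ((fun x => f n x * h x) - fun x => v x * h x) 1 μ ≤
      eLpNorm (fun x => v x - f n x) 2 μ * eLpNorm h 2 μ := by
    intro n
    have := eLpNorm_smul_le_mul_eLpNorm (p := 2) (q := 2) (r := 1) hh.1 (hv.sub (hf n)).1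
    refine le_trans (le_of_eq ?_) this
    rw [← eLpNorm_neg]
    congr 1
    ext x
    simp
    ring
  have h0 : Tendsto (fun n => eLpNorm (fun x => v x - f n x) 2 μ * eLpNorm h 2 μ) atTop (𝓝 0) := by
    simpa using ENNReal.Tendsto.mul_const hlim (Or.inr hh.2.ne)
  exact tendsto_of_tendsto_of_tendsto_of_le_of_le tendsto_const_nhds h0 (fun _ => zero_le) hb

lemma IsTest.memLp {W : Set (Pt d)} {φ : Pt d → ℝ} (h : IsTest W φ) :
    MemLp φ 2 (volume.restrict W) := memLp_of_contDiff h.1.continuous h.2.1 W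

lemma IsTest.memLp_partialDeriv {W : Set (Pt d)} {φ : Pt d → ℝ} (h : IsTest W φ) (i : Fin d) :
    MemLp (partialDeriv i φ) 2 (volume.restrict W) :=
  memLp_of_contDiff (continuous_partialDeriv h.1 i) (hasCompactSupport_partialDeriv h.2.1 i) W

lemma IsTest.eq_zero {W : Set (Pt d)} {φ : Pt d → ℝ} (h : IsTest W φ) {x : Pt d} (hx : x ∉ W) :
    φ x = 0 := image_eq_zero_of_notMem_tsupport fun h' => hx (h.2.2 h')

lemma IsTest.partialDeriv_eq_zero {W : Set (Pt d)} {φ : Pt d → ℝ} (h : IsTest W φ) {x : Pt d}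
    (i : Fin d) (hx : x ∉ W) : partialDeriv i φ x = 0 :=
  ProjFE.partialDeriv_eq_zero i fun h' => hx (h.2.2 h')

/-- Functions with vanishing trace can be integrated by parts against all smooth functions. -/
lemma H10Grad.integral_mul_partialDeriv {W : Set (Pt d)} {v : Pt d → ℝ} {G : Fin d → Pt d → ℝ}
    (h : H10Grad W v G) {ζ : Pt d → ℝ} (hζ : ContDiff ℝ ∞ ζ) (hc : HasCompactSupport ζ)
    (i : Fin d) : ∫ x in W, v x * partialDeriv i ζ x = - ∫ x in W, G i x * ζ x := by
  obtain ⟨hv, hG, φ, hφ, hlim, hlim'⟩ := h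
  have h1 := tendsto_integral_mul hv (fun n => (hφ n).memLp)
    (memLp_of_contDiff (continuous_partialDeriv hζ i) (hasCompactSupport_partialDeriv hc i) W) hlim
  have h2 := tendsto_integral_mul (hG i) (fun n => (hφ n).memLp_partialDeriv i)
    (memLp_of_contDiff hζ.continuous hc W) (hlim' i)
  refine tendsto_nhds_unique h1 (h2.neg.congr fun n => ?_)
  rw [setIntegral_eq_integral_of_forall_compl_eq_zero
      fun x hx => by simp [(hφ n).partialDeriv_eq_zero i hx],
    setIntegral_eq_integral_of_forall_compl_eq_zero fun x hx => by simp [(hφ n).eq_zero hx]]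
  rw [ProjFE.integral_mul_partialDeriv (hφ n).1 hζ hc]

/-- The weak-gradient identity in `MemH10` is redundant: it passes to the limit from the
approximating test functions. Afterwards only the limits have to be tracked. -/
lemma memH10_iff {W : Set (Pt d)} {v : Pt d → ℝ} : MemH10 W v ↔ ∃ G, H10Grad W v G := by
  constructor
  · rintro ⟨G, hG, hφ⟩
    exact ⟨G, hG.1, hG.2.1, hφ⟩
  · rintro ⟨G, hG⟩
    exact ⟨G, ⟨hG.1, hG.2.1, fun φ hφ i => hG.integral_mul_partialDeriv hφ.1 hφ.2.1 i⟩, hG.2.2⟩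

lemma MemH10.congr {W : Set (Pt d)} {v w : Pt d → ℝ} (h : MemH10 W v)
    (hvw : v =ᵐ[volume.restrict W] w) : MemH10 W w := by
  obtain ⟨G, hv, hG, φ, hφ, hlim, hlim'⟩ := memH10_iff.1 h
  refine memH10_iff.2 ⟨G, hv.ae_eq hvw, hG, φ, hφ, hlim.congr fun n => ?_, hlim'⟩
  exact eLpNorm_congr_ae (hvw.mono fun x hx => by simp [hx])

lemma IsTest.zero (W : Set (Pt d)) : IsTest W 0 :=
  ⟨contDiff_const, HasCompactSupport.zero, by simp⟩

lemma IsTest.add {W : Set (Pt d)} {φ ψ : Pt d → ℝ} (hφ : IsTest W φ) (hψ : IsTest W ψ) :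
    IsTest W (φ + ψ) :=
  ⟨hφ.1.add hψ.1, hφ.2.1.add hψ.2.1,
    (tsupport_add φ ψ).trans (Set.union_subset hφ.2.2 hψ.2.2)⟩

lemma IsTest.smul {W : Set (Pt d)} {φ : Pt d → ℝ} (c : ℝ) (hφ : IsTest W φ) :
    IsTest W (c • φ) :=
  ⟨contDiff_const.smul hφ.1, hφ.2.1.smul_left (f := fun _ => c),
    (tsupport_smul_subset_right (fun _ => c) φ).trans hφ.2.2⟩

lemma partialDeriv_add {f g : Pt d → ℝ} {x : Pt d} (i : Fin d) (hf : DifferentiableAt ℝ f x)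
    (hg : DifferentiableAt ℝ g x) :
    partialDeriv i (f + g) x = partialDeriv i f x + partialDeriv i g x := by
  simp [partialDeriv, fderiv_add hf hg]

lemma partialDeriv_smul {f : Pt d → ℝ} {x : Pt d} (c : ℝ) (i : Fin d)
    (hf : DifferentiableAt ℝ f x) :
    partialDeriv i (c • f) x = c * partialDeriv i f x := by
  simp [partialDeriv, fderiv_const_smul hf]

lemma IsTest.differentiable {W : Set (Pt d)} {φ : Pt d → ℝ} (h : IsTest W φ) :
    Differentiable ℝ φ := h.1.differentiable (by simp)

lemma tendsto_eLpNorm_sub_add {α : Type*} [MeasurableSpace α] {μ : Measure α} {v w : α → ℝ}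
    {f g : ℕ → α → ℝ} (hv : MemLp v 2 μ) (hf : ∀ n, MemLp (f n) 2 μ) (hw : MemLp w 2 μ)
    (hg : ∀ n, MemLp (g n) 2 μ)
    (h1 : Tendsto (fun n => eLpNorm (fun x => v x - f n x) 2 μ) atTop (𝓝 0))
    (h2 : Tendsto (fun n => eLpNorm (fun x => w x - g n x) 2 μ) atTop (𝓝 0)) :
    Tendsto (fun n => eLpNorm (fun x => (v x + w x) - (f n x + g n x)) 2 μ) atTop (𝓝 0) := by
  refine tendsto_of_tendsto_of_tendsto_of_le_of_le tendsto_const_nhds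
    (by simpa using h1.add h2) (fun _ => zero_le) fun n => ?_
  refine le_trans (le_of_eq ?_) (eLpNorm_add_le (hv.sub (hf n)).1 (hw.sub (hg n)).1 (by norm_num))
  congr 1
  ext x
  simp
  ring

lemma MemH10.add {W : Set (Pt d)} {v w : Pt d → ℝ} (h : MemH10 W v) (h' : MemH10 W w) :
    MemH10 W (v + w) := by
  obtain ⟨G, hv, hG, φ, hφ, hlim, hlim'⟩ := memH10_iff.1 h
  obtain ⟨H, hw, hH, ψ, hψ, hlim₂, hlim₂'⟩ := memH10_iff.1 h'
  refine memH10_iff.2 ⟨G + H, hv.add hw, fun i => (hG i).add (hH i), fun n => φ n + ψ n,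
    fun n => (hφ n).add (hψ n), ?_, fun i => ?_⟩
  · exact tendsto_eLpNorm_sub_add hv (fun n => (hφ n).memLp) hw (fun n => (hψ n).memLp) hlim hlim₂
  · refine (tendsto_eLpNorm_sub_add (hG i) (fun n => (hφ n).memLp_partialDeriv i) (hH i)
      (fun n => (hψ n).memLp_partialDeriv i) (hlim' i) (hlim₂' i)).congr fun n => ?_
    congr 1
    ext x
    rw [partialDeriv_add i ((hφ n).differentiable x) ((hψ n).differentiable x)]
    simp

lemma tendsto_eLpNorm_sub_smul {α : Type*} [MeasurableSpace α] {μ : Measure α} {v : α → ℝ}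
    {f : ℕ → α → ℝ} (c : ℝ)
    (h1 : Tendsto (fun n => eLpNorm (fun x => v x - f n x) 2 μ) atTop (𝓝 0)) :
    Tendsto (fun n => eLpNorm (fun x => c * v x - c * f n x) 2 μ) atTop (𝓝 0) := by
  have : Tendsto (fun n => ‖c‖ₑ * eLpNorm (fun x => v x - f n x) 2 μ) atTop (𝓝 0) := by
    simpa using ENNReal.Tendsto.const_mul h1 (Or.inr (by simp))
  refine this.congr fun n => ?_
  rw [← eLpNorm_const_smul]
  congr 1
  ext x
  simp
  ring

lemma MemH10.smul {W : Set (Pt d)} {v : Pt d → ℝ} (c : ℝ) (h : MemH10 W v) :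
    MemH10 W (c • v) := by
  obtain ⟨G, hv, hG, φ, hφ, hlim, hlim'⟩ := memH10_iff.1 h
  refine memH10_iff.2 ⟨c • G, hv.const_smul c, fun i => (hG i).const_smul c, fun n => c • φ n,
    fun n => (hφ n).smul c, ?_, fun i => ?_⟩
  · exact tendsto_eLpNorm_sub_smul c hlim
  · refine (tendsto_eLpNorm_sub_smul c (hlim' i)).congr fun n => ?_
    congr 1
    ext x
    rw [partialDeriv_smul c i ((hφ n).differentiable x)]
    simp

lemma MemH10.zero (W : Set (Pt d)) : MemH10 W 0 := by
  refine memH10_iff.2 ⟨0, MemLp.zero, fun _ => MemLp.zero, fun _ => 0, fun _ => .zero W, ?_, ?_⟩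
  · simp
  · simp [partialDeriv]

lemma MemH10.sum {ι : Type*} {W : Set (Pt d)} (s : Finset ι) {v : ι → Pt d → ℝ}
    (h : ∀ i ∈ s, MemH10 W (v i)) : MemH10 W (∑ i ∈ s, v i) := by
  classical
  induction s using Finset.induction_on with
  | empty => simpa using MemH10.zero W
  | insert a s ha ih =>
    rw [Finset.sum_insert ha]
    exact (h a (by simp)).add (ih fun i hi => h i (by simp [hi]))

/-- Extension by zero of functions with vanishing trace. -/
lemma H10Grad.extend {W W' : Set (Pt d)} {v : Pt d → ℝ} {G : Fin d → Pt d → ℝ}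
    (h : H10Grad W v G) (hW : MeasurableSet W) (hWW' : W ⊆ W') :
    H10Grad W' (W.indicator v) (fun i => W.indicator (G i)) := by
  obtain ⟨hv, hG, φ, hφ, hlim, hlim'⟩ := h
  have hr : (volume.restrict W').restrict W = volume.restrict W := by
    rw [Measure.restrict_restrict hW, Set.inter_eq_left.2 hWW']
  have hi : ∀ f g : Pt d → ℝ, (∀ x ∉ W, g x = 0) →
      eLpNorm (fun x => W.indicator f x - g x) 2 (volume.restrict W') =
        eLpNorm (fun x => f x - g x) 2 (volume.restrict W) := by
    intro f g hg
    rw [← hr, ← eLpNorm_indicator_eq_eLpNorm_restrict hW]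
    congr 1
    ext x
    by_cases hx : x ∈ W <;> simp [hx, hg]
  refine ⟨?_, fun i => ?_, φ, fun n => ⟨(hφ n).1, (hφ n).2.1, (hφ n).2.2.trans hWW'⟩, ?_,
    fun i => ?_⟩
  · rw [memLp_indicator_iff_restrict hW, hr]
    exact hv
  · rw [memLp_indicator_iff_restrict hW, hr]
    exact hG i
  · exact hlim.congr fun n => (hi _ _ fun x hx => (hφ n).eq_zero hx).symm
  · exact (hlim' i).congr fun n => (hi _ _ fun x hx => (hφ n).partialDeriv_eq_zero i hx).symm

lemma MemH10.extend {W W' : Set (Pt d)} {v : Pt d → ℝ} (h : MemH10 W v) (hW : MeasurableSet W)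
    (hWW' : W ⊆ W') (hv : ∀ x ∉ W, v x = 0) : MemH10 W' v := by
  obtain ⟨G, hG⟩ := memH10_iff.1 h
  have := hG.extend hW hWW'
  rw [Set.indicator_eq_self.2 fun x hx => by_contra fun h => hx (hv x h)] at this
  exact memH10_iff.2 ⟨_, this⟩

/-- A diagonal argument: pick a test function within 1/n of the n-th approximant and apply the
triangle inequality. For n = 0 the tolerance in `ENNReal` is `⊤`, which is harmless. -/
lemma H10Grad.of_tendsto {W : Set (Pt d)} {v : Pt d → ℝ} {G : Fin d → Pt d → ℝ}
    {w : ℕ → Pt d → ℝ} {H : ℕ → Fin d → Pt d → ℝ} (hw : ∀ n, H10Grad W (w n) (H n))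
    (hv : MemLp v 2 (volume.restrict W)) (hG : ∀ i, MemLp (G i) 2 (volume.restrict W))
    (hlim : Tendsto (fun n => eLpNorm (fun x => v x - w n x) 2 (volume.restrict W)) atTop (𝓝 0))
    (hlim' : ∀ i, Tendsto (fun n => eLpNorm (fun x => G i x - H n i x) 2 (volume.restrict W)) atTop
      (𝓝 0)) : H10Grad W v G := by
  have key : ∀ n : ℕ, ∃ φ, IsTest W φ ∧
      eLpNorm (fun x => w n x - φ x) 2 (volume.restrict W) ≤ (n : ENNReal)⁻¹ ∧
      ∀ i, eLpNorm (fun x => H n i x - partialDeriv i φ x) 2 (volume.restrict W) ≤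
        (n : ENNReal)⁻¹ := by
    intro n
    obtain ⟨-, -, φ, hφ, h1, h2⟩ := hw n
    have hn : (0 : ENNReal) < (n : ENNReal)⁻¹ := by simp
    have e1 := h1.eventually_le_const hn
    have e2 := eventually_all.2 fun i => (h2 i).eventually_le_const hn
    obtain ⟨m, hm⟩ := (e1.and e2).exists
    exact ⟨φ m, hφ m, hm.1, hm.2⟩
  choose φ hφ h1 h2 using key
  have gen : ∀ {a : Pt d → ℝ} {b c : ℕ → Pt d → ℝ}, MemLp a 2 (volume.restrict W) →
      (∀ n, MemLp (b n) 2 (volume.restrict W)) → (∀ n, MemLp (c n) 2 (volume.restrict W)) →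
      Tendsto (fun n => eLpNorm (fun x => a x - b n x) 2 (volume.restrict W)) atTop (𝓝 0) →
      (∀ n : ℕ, eLpNorm (fun x => b n x - c n x) 2 (volume.restrict W) ≤ (n : ENNReal)⁻¹) →
      Tendsto (fun n => eLpNorm (fun x => a x - c n x) 2 (volume.restrict W)) atTop (𝓝 0) := by
    intro a b c ha hb hc h h'
    have hs := h.add ENNReal.tendsto_inv_nat_nhds_zero
    rw [add_zero] at hs
    refine tendsto_of_tendsto_of_tendsto_of_le_of_le tendsto_const_nhds hs (fun _ => zero_le)
      fun n => ?_
    refine le_trans (le_of_eq ?_) ((eLpNorm_add_le (ha.sub (hb n)).1 ((hb n).sub (hc n)).1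
      (by norm_num)).trans (add_le_add le_rfl (h' n)))
    congr 1
    ext x
    simp
  exact ⟨hv, hG, φ, hφ, gen hv (fun n => (hw n).1) (fun n => (hφ n).memLp) hlim h1,
    fun i => gen (hG i) (fun n => (hw n).2.1 i) (fun n => (hφ n).memLp_partialDeriv i) (hlim' i)
      fun n => h2 n i⟩

/-! ### Mollification -/

/-- A bump function supported in the ball of radius `1 / (n + 1)`. -/
noncomputable def bump (d n : ℕ) : ContDiffBump (0 : Pt d) where
  rIn := 1 / (2 * ((n : ℝ) + 1))
  rOut := 1 / ((n : ℝ) + 1)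
  rIn_pos := by positivity
  rIn_lt_rOut := by
    apply one_div_lt_one_div_of_lt <;> linarith [n.cast_nonneg (α := ℝ)]

lemma tendsto_bump_rOut : Tendsto (fun n => (bump d n).rOut) atTop (𝓝 0) :=
  tendsto_one_div_add_atTop_nhds_zero_nat

/-- Mollification of `f` at the scale `1 / (n + 1)`. -/
noncomputable def mollify (n : ℕ) (f : Pt d → ℝ) : Pt d → ℝ :=
  convolution ((bump d n).normed volume) f (ContinuousLinearMap.lsmul ℝ ℝ) volume

lemma mollify_apply (n : ℕ) (f : Pt d → ℝ) (x : Pt d) :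
    mollify n f x = ∫ t, (bump d n).normed volume (x - t) * f t := by
  simp [mollify, convolution_eq_swap]

lemma contDiff_mollify (n : ℕ) {f : Pt d → ℝ} (hf : LocallyIntegrable f volume) :
    ContDiff ℝ ∞ (mollify n f) :=
  (bump d n).hasCompactSupport_normed.contDiff_convolution_left _ (bump d n).contDiff_normed hf

lemma ae_tendsto_mollify {f : Pt d → ℝ} (hf : LocallyIntegrable f volume) :
    ∀ᵐ x, Tendsto (fun n => mollify n f x) atTop (𝓝 (f x)) := by
  -- Lebesgue differentiation needs a bounded ratio of outer to inner radius; for `bump` it is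
  -- exactly 2.
  refine ContDiffBump.ae_convolution_tendsto_right_of_locallyIntegrable (K := 2)
    tendsto_bump_rOut (Eventually.of_forall fun n => le_of_eq ?_) hf
  simp only [bump]
  field_simp

lemma abs_mollify_le (n : ℕ) {f : Pt d → ℝ} {C : ℝ} (hf : ∀ᵐ x, |f x| ≤ C) (x : Pt d) :
    |mollify n f x| ≤ C := by
  have hint : Integrable (fun t => (bump d n).normed volume (x - t) * C) volume :=
    ((bump d n).integrable_normed.comp_sub_left x).mul_const C
  have h := norm_integral_le_of_norm_le hint
    (f := fun t => (bump d n).normed volume (x - t) * f t) (hf.mono fun t ht => by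
      rw [norm_mul, Real.norm_of_nonneg ((bump d n).nonneg_normed _)]
      exact mul_le_mul_of_nonneg_left ht ((bump d n).nonneg_normed _))
  rw [mollify_apply, ← Real.norm_eq_abs]
  refine h.trans (le_of_eq ?_)
  rw [integral_mul_const, integral_sub_left_eq_self (fun t => (bump d n).normed volume t) volume x,
    (bump d n).integral_normed, one_mul]

lemma tsupport_mollify_subset (n : ℕ) (f : Pt d → ℝ) :
    tsupport (mollify n f) ⊆ Metric.cthickening (1 / ((n : ℝ) + 1)) (tsupport f) := by
  refine closure_minimal ?_ Metric.isClosed_cthickening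
  refine (support_convolution_subset _).trans ?_
  rintro _ ⟨y, hy, z, hz, rfl⟩
  rw [(bump d n).support_normed_eq] at hy
  refine Metric.mem_cthickening_of_dist_le _ z _ _ (subset_tsupport _ hz) ?_
  simpa [bump] using (Metric.mem_ball.1 hy).le

/-- The derivative falls on the smooth kernel η, and y ↦ η(x - y) is a test function on ℝ^d. The
weak identity moves the derivative to g; its minus sign cancels the one coming from the reflection y
↦ x - y. -/
lemma partialDeriv_mollify (n : ℕ) (i : Fin d) {g H : Pt d → ℝ}
    (hg : LocallyIntegrable g volume)
    (hw : ∀ ζ : Pt d → ℝ, ContDiff ℝ ∞ ζ → HasCompactSupport ζ →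
      ∫ x, g x * partialDeriv i ζ x = - ∫ x, H x * ζ x) (x : Pt d) :
    partialDeriv i (mollify n g) x = mollify n H x := by
  set η : Pt d → ℝ := (bump d n).normed volume with hη
  have hηs : ContDiff ℝ ∞ η := (bump d n).contDiff_normed
  have hηc : HasCompactSupport η := (bump d n).hasCompactSupport_normed
  have h1 := (hηc.hasFDerivAt_convolution_left (ContinuousLinearMap.lsmul ℝ ℝ)
    (hηs.of_le (by simp)) hg x).fderiv
  have hex := (hηc.fderiv ℝ).convolutionExists_left
    (L := (ContinuousLinearMap.lsmul ℝ ℝ : ℝ →L[ℝ] ℝ →L[ℝ] ℝ).precompL (Pt d))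
    (hηs.continuous_fderiv (by simp)) hg x
  have h2 : partialDeriv i (mollify n g) x = ∫ t, g (x - t) * partialDeriv i η t := by
    simp only [partialDeriv, mollify]
    rw [h1, convolution, ContinuousLinearMap.integral_apply hex]
    congr 1
    ext t
    simp [ContinuousLinearMap.precompL, mul_comm]
  have h3 : ∫ t, g (x - t) * partialDeriv i η t = ∫ y, g y * partialDeriv i η (x - y) := by
    rw [← integral_sub_left_eq_self (fun t => g (x - t) * partialDeriv i η t) volume x]
    simp
  have h4 : ∀ y, partialDeriv i (fun y => η (x - y)) y = - partialDeriv i η (x - y) := by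
    intro y
    simp only [partialDeriv]
    have : HasFDerivAt (fun y => η (x - y)) ((fderiv ℝ η (x - y)).comp
        (-ContinuousLinearMap.id ℝ (Pt d))) y :=
      ((hηs.differentiable (by simp)) (x - y)).hasFDerivAt.comp y
        (by simpa using (hasFDerivAt_id y).const_sub x)
    rw [this.fderiv]
    simp
  have h5 := hw (fun y => η (x - y)) (hηs.comp (contDiff_const.sub contDiff_id))
    (hηc.comp_homeomorph (Homeomorph.subLeft x))
  simp only [h4, mul_neg, integral_neg, neg_inj] at h5
  rw [h2, h3, h5, mollify_apply]
  simp only [mul_comm, hη]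

/-- Dominated convergence for the squares, with majorant (2C)² on the closure of B, a set of finite
measure. -/
lemma tendsto_eLpNorm_of_dominated {W B : Set (Pt d)} (hB : Bornology.IsBounded B) {C : ℝ}
    {F : ℕ → Pt d → ℝ} {f : Pt d → ℝ} (hF : ∀ n, AEStronglyMeasurable (F n) volume)
    (hf : AEStronglyMeasurable f volume) (hFC : ∀ n x, |F n x| ≤ C) (hfC : ∀ x, |f x| ≤ C)
    (hFB : ∀ n, ∀ x ∉ B, F n x = 0) (hfB : ∀ x ∉ B, f x = 0)
    (hlim : ∀ᵐ x, Tendsto (fun n => F n x) atTop (𝓝 (f x))) :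
    Tendsto (fun n => eLpNorm (fun x => f x - F n x) 2 (volume.restrict W)) atTop (𝓝 0) := by
  have key : Tendsto (fun n => eLpNorm (fun x => f x - F n x) 2 volume) atTop (𝓝 0) := by
    simp only [eLpNorm_eq_lintegral_rpow_enorm_toReal (p := 2) (by simp) (by simp)]
    have hl : Tendsto (fun n => ∫⁻ x, ‖f x - F n x‖ₑ ^ (2 : ENNReal).toReal) atTop
        (𝓝 (∫⁻ _ : Pt d, 0)) := by
      refine tendsto_lintegral_of_dominated_convergence'
        ((closure B).indicator fun _ => ENNReal.ofReal (2 * C) ^ (2 : ENNReal).toReal)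
        (fun n => ((hf.sub (hF n)).enorm.pow_const _)) (fun n => Eventually.of_forall fun x => ?_)
        ?_ ?_
      · by_cases hx : x ∈ closure B
        · simp only [Set.indicator_of_mem hx]
          refine ENNReal.rpow_le_rpow ?_ (by simp)
          rw [← ofReal_norm]
          refine ENNReal.ofReal_le_ofReal ?_
          rw [Real.norm_eq_abs]
          linarith [abs_sub (f x) (F n x), hFC n x, hfC x]
        · have hx' : x ∉ B := fun h => hx (subset_closure h)
          simp [hfB x hx', hFB n x hx']
      · rw [lintegral_indicator isClosed_closure.measurableSet, lintegral_const]
        refine ENNReal.mul_ne_top (ENNReal.rpow_ne_top_of_nonneg (by simp) ENNReal.ofReal_ne_top) ?_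
        rw [Measure.restrict_apply_univ]
        exact hB.closure.measure_lt_top.ne
      · filter_upwards [hlim] with x hx
        have h1 : Tendsto (fun n => f x - F n x) atTop (𝓝 0) := by
          simpa using (tendsto_const_nhds (x := f x)).sub hx
        have h2 := (ENNReal.continuous_rpow_const (y := (2 : ENNReal).toReal)).tendsto 0 |>.comp
          (by simpa using h1.enorm)
        simpa [Function.comp_def] using h2
    have h2 := (ENNReal.continuous_rpow_const (y := 1 / (2 : ENNReal).toReal)).tendsto 0
    simp only [lintegral_zero] at hl
    simpa [Function.comp_def] using h2.comp hl
  exact tendsto_of_tendsto_of_tendsto_of_le_of_le tendsto_const_nhds key (fun _ => zero_le)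
    fun n => eLpNorm_mono_measure _ Measure.restrict_le_self

lemma memLp_of_bounded {W B : Set (Pt d)} (hB : Bornology.IsBounded B) {C : ℝ} {f : Pt d → ℝ}
    (hf : AEStronglyMeasurable f volume) (hfC : ∀ x, |f x| ≤ C) (hfB : ∀ x ∉ B, f x = 0) :
    MemLp f 2 (volume.restrict W) := by
  have h1 : MemLp f 2 (volume.restrict (closure B)) := by
    have : IsFiniteMeasure (volume.restrict (closure B)) :=
      ⟨by rw [Measure.restrict_apply_univ]; exact hB.closure.measure_lt_top⟩
    exact MemLp.of_bound hf.restrict C (Eventually.of_forall hfC)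
  rw [← memLp_indicator_iff_restrict isClosed_closure.measurableSet, Set.indicator_eq_self.2
    fun x hx => by_contra fun h => hx (hfB x fun h' => h (subset_closure h'))] at h1
  exact h1.restrict W

/-! ### Lipschitz functions with vanishing trace -/

lemma integral_mul_partialDeriv_of_lipschitz {f : Pt d → ℝ} {K : NNReal} (hf : LipschitzWith K f)
    (i : Fin d) {ζ : Pt d → ℝ} (hζ : ContDiff ℝ ∞ ζ) (hc : HasCompactSupport ζ) :
    ∫ x, f x * partialDeriv i ζ x =
      - ∫ x, lineDeriv ℝ f x (EuclideanSpace.single i 1) * ζ x := by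
  obtain ⟨D, hD⟩ := hζ.lipschitzWith_of_hasCompactSupport hc (by simp)
  rw [hf.integral_lineDeriv_mul_eq hD hc, ← integral_neg]
  congr 1
  ext x
  rw [lineDeriv_neg, (hζ.differentiable (by simp) x).lineDeriv_eq_fderiv, partialDeriv]
  ring

lemma norm_single_one (i : Fin d) : ‖(EuclideanSpace.single i (1 : ℝ) : Pt d)‖ = 1 := by
  simp

lemma abs_lineDeriv_single_le {f : Pt d → ℝ} {K : NNReal} (hf : LipschitzWith K f) (i : Fin d)
    (x : Pt d) : |lineDeriv ℝ f x (EuclideanSpace.single i 1)| ≤ K := by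
  have := norm_lineDeriv_le_of_lipschitz ℝ hf (x₀ := x) (v := EuclideanSpace.single i (1 : ℝ))
  rwa [norm_single_one, mul_one] at this

lemma exists_abs_le_of_hasCompactSupport {f : Pt d → ℝ} (hf : Continuous f)
    (hc : HasCompactSupport f) : ∃ C, ∀ x, |f x| ≤ C :=
  hc.exists_bound_of_continuous hf

lemma lineDeriv_eq_zero_of_notMem_tsupport {f : Pt d → ℝ} {x : Pt d} (v : Pt d)
    (hx : x ∉ tsupport f) : lineDeriv ℝ f x v = 0 := by
  have h : f =ᶠ[𝓝 x] fun _ => 0 := notMem_tsupport_iff_eventuallyEq.1 hx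
  rw [h.lineDeriv_eq]
  simp [lineDeriv]

/-- Mollifications are test functions once the radius is below the distance from the support to the
complement of W. They and their derivatives are uniformly bounded and converge almost everywhere. -/
lemma H10Grad.of_lipschitz_of_tsupport_subset {W : Set (Pt d)} (hW : IsOpen W) {f : Pt d → ℝ}
    {K : NNReal} (hf : LipschitzWith K f) (hc : HasCompactSupport f) (hfW : tsupport f ⊆ W) :
    H10Grad W f (fun i x => lineDeriv ℝ f x (EuclideanSpace.single i 1)) := by
  obtain ⟨δ, hδ, hδW⟩ := hc.isCompact.exists_cthickening_subset_open hW hfW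
  -- The sequence starts at index N, so that every mollification radius is less than δ.
  obtain ⟨N, hN⟩ := exists_nat_one_div_lt hδ
  obtain ⟨C, hC⟩ := exists_abs_le_of_hasCompactSupport hf.continuous hc
  have hfl : LocallyIntegrable f volume := hf.continuous.locallyIntegrable
  have hgl : ∀ i : Fin d, LocallyIntegrable
      (fun x => lineDeriv ℝ f x (EuclideanSpace.single i 1)) volume :=
    fun i => hf.locallyIntegrable_lineDeriv _
  have hmono : ∀ n : ℕ, 1 / (((n + N : ℕ) : ℝ) + 1) ≤ 1 / ((N : ℝ) + 1) := fun n => by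
    apply one_div_le_one_div_of_le (by positivity)
    push_cast
    linarith [n.cast_nonneg (α := ℝ)]
  have hts : ∀ n, tsupport (mollify (n + N) f) ⊆ Metric.cthickening δ (tsupport f) := fun n =>
    (tsupport_mollify_subset (n + N) f).trans
      (Metric.cthickening_mono ((hmono n).trans hN.le) _)
  have hbd : Bornology.IsBounded (Metric.cthickening δ (tsupport f)) :=
    hc.isCompact.isBounded.cthickening
  have hsub : tsupport f ⊆ Metric.cthickening δ (tsupport f) :=
    Metric.self_subset_cthickening _
  have htest : ∀ n, IsTest W (mollify (n + N) f) := fun n =>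
    ⟨contDiff_mollify _ hfl, HasCompactSupport.of_support_subset_isCompact
      hc.isCompact.cthickening ((subset_tsupport _).trans (hts n)), (hts n).trans hδW⟩
  have hpd : ∀ n i, partialDeriv i (mollify n f) =
      mollify n (fun x => lineDeriv ℝ f x (EuclideanSpace.single i 1)) := fun n i => funext fun x =>
    partialDeriv_mollify n i hfl (fun ζ hζ hζc =>
      integral_mul_partialDeriv_of_lipschitz hf i hζ hζc) x
  refine ⟨memLp_of_contDiff hf.continuous hc W, fun i => memLp_of_bounded hbd
      (measurable_lineDeriv hf.continuous).aestronglyMeasurable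
      (abs_lineDeriv_single_le hf i)
      fun x hx => lineDeriv_eq_zero_of_notMem_tsupport _ fun h => hx (hsub h),
    fun n => mollify (n + N) f, htest, ?_, fun i => ?_⟩
  · refine tendsto_eLpNorm_of_dominated hbd (C := C)
      (fun n => (htest n).1.continuous.aestronglyMeasurable) hf.continuous.aestronglyMeasurable
      (fun n x => abs_mollify_le _ (Eventually.of_forall hC) x) hC
      (fun n x hx => image_eq_zero_of_notMem_tsupport fun h => hx (hts n h))
      (fun x hx => image_eq_zero_of_notMem_tsupport fun h => hx (hsub h)) ?_
    filter_upwards [ae_tendsto_mollify hfl] with x hx using hx.comp (tendsto_add_atTop_nat N)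
  · refine tendsto_eLpNorm_of_dominated hbd (C := K)
      (fun n => (continuous_partialDeriv (htest n).1 i).aestronglyMeasurable)
      (measurable_lineDeriv hf.continuous).aestronglyMeasurable
      (fun n x => ?_) (abs_lineDeriv_single_le hf i)
      (fun n x hx => partialDeriv_eq_zero i fun h => hx (hts n h))
      (fun x hx => lineDeriv_eq_zero_of_notMem_tsupport _ fun h => hx (hsub h)) ?_
    · rw [hpd]
      exact abs_mollify_le _ (Eventually.of_forall (abs_lineDeriv_single_le hf i)) x
    · filter_upwards [ae_tendsto_mollify (hgl i)] with x hx
      simp only [hpd]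
      exact hx.comp (tendsto_add_atTop_nat N)

/-- Soft thresholding. -/
noncomputable def softThreshold (ε : ℝ) (f : Pt d → ℝ) (x : Pt d) : ℝ :=
  f x - max (-ε) (min ε (f x))

lemma softThreshold_eq_zero {ε : ℝ} {f : Pt d → ℝ} {x : Pt d} (h : |f x| ≤ ε) :
    softThreshold ε f x = 0 := by
  obtain ⟨h1, h2⟩ := abs_le.1 h
  simp [softThreshold, h1, h2]

lemma abs_softThreshold_le {ε : ℝ} (hε : 0 ≤ ε) (f : Pt d → ℝ) (x : Pt d) :
    |softThreshold ε f x| ≤ |f x| := by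
  simp only [softThreshold]
  rcases max_cases (-ε) (min ε (f x)) with h | h <;>
  rcases min_cases ε (f x) with h' | h' <;>
  rcases abs_cases (f x) with h'' | h'' <;> rw [abs_le] <;> constructor <;> linarith

lemma abs_sub_softThreshold_le {ε : ℝ} (hε : 0 ≤ ε) (f : Pt d → ℝ) (x : Pt d) :
    |f x - softThreshold ε f x| ≤ ε := by
  simp only [softThreshold, sub_sub_cancel]
  exact abs_le.2 ⟨le_max_left _ _, max_le (by linarith) (min_le_left _ _)⟩

lemma LipschitzWith.softThreshold {f : Pt d → ℝ} {K : NNReal} (hf : LipschitzWith K f) (ε : ℝ) :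
    LipschitzWith (K + K) (softThreshold ε f) :=
  hf.sub ((hf.const_min ε).const_max (-ε))

/-- The purpose of thresholding: the support of f may touch the boundary of W, but if f vanishes off
W then the closed set {ε ≤ |f|} lies inside W. -/
lemma tsupport_softThreshold_subset {f : Pt d → ℝ} (hf : Continuous f) (ε : ℝ) :
    tsupport (softThreshold ε f) ⊆ {x | ε ≤ |f x|} := by
  refine closure_minimal (fun x hx => ?_) (isClosed_le continuous_const hf.abs)
  by_contra h
  exact hx (softThreshold_eq_zero (le_of_lt (not_le.1 h)))

lemma lineDeriv_add_const (f : Pt d → ℝ) (c : ℝ) (x v : Pt d) :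
    lineDeriv ℝ (fun y => f y + c) x v = lineDeriv ℝ f x v := by
  simp [lineDeriv]

lemma lineDeriv_softThreshold_of_lt {f : Pt d → ℝ} (hf : Continuous f) {ε : ℝ} (hε : 0 < ε)
    {x : Pt d} (v : Pt d) (hx : ε < |f x|) :
    lineDeriv ℝ (softThreshold ε f) x v = lineDeriv ℝ f x v := by
  rcases lt_abs.1 hx with h | h
  · have : softThreshold ε f =ᶠ[𝓝 x] fun y => f y + -ε := by
      filter_upwards [(hf.tendsto x).eventually_const_lt h] with y hy
      rw [softThreshold, min_eq_left hy.le, max_eq_right (by linarith)]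
      ring
    rw [this.lineDeriv_eq, lineDeriv_add_const]
  · have : softThreshold ε f =ᶠ[𝓝 x] fun y => f y + ε := by
      filter_upwards [(hf.tendsto x).eventually_lt_const (show f x < -ε by linarith)] with y hy
      rw [softThreshold, min_eq_right (by linarith), max_eq_left (by linarith)]
      ring
    rw [this.lineDeriv_eq, lineDeriv_add_const]

lemma lineDeriv_softThreshold_of_eq_zero {f : Pt d → ℝ} (hf : Continuous f) {ε : ℝ} (hε : 0 < ε)
    {x : Pt d} (v : Pt d) (hx : f x = 0) :
    lineDeriv ℝ (softThreshold ε f) x v = 0 := by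
  refine lineDeriv_eq_zero_of_notMem_tsupport v fun h => ?_
  have := tsupport_softThreshold_subset hf ε h
  simp only [Set.mem_ofPred_eq, hx, abs_zero] at this
  linarith

/-- A compactly supported Lipschitz function which vanishes off an open set has vanishing trace. -/
lemma MemH10.of_lipschitz {W : Set (Pt d)} (hW : IsOpen W) {f : Pt d → ℝ} {K : NNReal}
    (hf : LipschitzWith K f) (hc : HasCompactSupport f) (hfW : ∀ x ∉ W, f x = 0) :
    MemH10 W f := by
  obtain ⟨C, hC⟩ := exists_abs_le_of_hasCompactSupport hf.continuous hc
  have hcont : ∀ ε, Continuous (softThreshold ε f) :=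
    fun ε => (LipschitzWith.softThreshold hf ε).continuous
  set e : ℕ → ℝ := fun n => 1 / ((n : ℝ) + 1) with he
  have he0 : ∀ n, 0 < e n := fun n => by positivity
  have hel : Tendsto e atTop (𝓝 0) := tendsto_one_div_add_atTop_nhds_zero_nat
  have hsupp : ∀ ε, 0 ≤ ε → ∀ x ∉ tsupport f, softThreshold ε f x = 0 := fun ε hε x hx =>
    softThreshold_eq_zero (by rw [image_eq_zero_of_notMem_tsupport hx, abs_zero]; exact hε)
  have htsupp : ∀ n, tsupport (softThreshold (e n) f) ⊆ tsupport f := fun n =>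
    closure_minimal (fun x hx => by_contra fun h => hx (hsupp _ (he0 n).le x h))
      (isClosed_tsupport f)
  have happrox : ∀ n, H10Grad W (softThreshold (e n) f)
      (fun i x => lineDeriv ℝ (softThreshold (e n) f) x (EuclideanSpace.single i 1)) := by
    intro n
    refine H10Grad.of_lipschitz_of_tsupport_subset hW (LipschitzWith.softThreshold hf (e n))
      (HasCompactSupport.of_support_subset_isCompact hc.isCompact
        ((subset_tsupport _).trans (htsupp n))) ?_
    intro x hx
    have := tsupport_softThreshold_subset hf.continuous (e n) hx
    by_contra h
    simp only [Set.mem_ofPred_eq, hfW x h, abs_zero] at this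
    linarith [he0 n]
  -- The limit gradient is that of f cut off on {f = 0}. Where f vanishes, all thresholded functions
  -- have derivative zero; elsewhere their derivative is eventually that of f. The derivative of f
  -- on its zero set thus never has to be known.
  have hmeas : ∀ i : Fin d, Measurable ({x | f x = 0}ᶜ.indicator
      fun x => lineDeriv ℝ f x (EuclideanSpace.single i 1)) := fun i =>
    (measurable_lineDeriv hf.continuous).indicator
      (isClosed_eq hf.continuous continuous_const).measurableSet.compl
  have hbound : ∀ (i : Fin d) x, |{x | f x = 0}ᶜ.indicator
      (fun x => lineDeriv ℝ f x (EuclideanSpace.single i 1)) x| ≤ (K + K : NNReal) := by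
    intro i x
    by_cases hx : f x = 0
    · simp [hx]
    · have := abs_lineDeriv_single_le hf i x
      have hK : (0 : ℝ) ≤ K := K.2
      simp only [Set.indicator, Set.mem_compl_iff, Set.mem_ofPred_eq, hx, not_false_eq_true,
        if_true]
      push_cast
      linarith
  have hzero : ∀ (i : Fin d), ∀ x ∉ tsupport f, {x | f x = 0}ᶜ.indicator
      (fun x => lineDeriv ℝ f x (EuclideanSpace.single i 1)) x = 0 := fun i x hx => by
    simp [image_eq_zero_of_notMem_tsupport hx]
  refine memH10_iff.2 ⟨fun i => {x | f x = 0}ᶜ.indicator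
    fun x => lineDeriv ℝ f x (EuclideanSpace.single i 1), H10Grad.of_tendsto happrox
    (memLp_of_contDiff hf.continuous hc W)
    (fun i => memLp_of_bounded hc.isCompact.isBounded (hmeas i).aestronglyMeasurable (hbound i)
      (hzero i)) ?_ fun i => ?_⟩
  · refine tendsto_eLpNorm_of_dominated hc.isCompact.isBounded (C := C)
      (fun n => (hcont _).aestronglyMeasurable) hf.continuous.aestronglyMeasurable
      (fun n x => (abs_softThreshold_le (he0 n).le f x).trans (hC x)) hC
      (fun n => hsupp _ (he0 n).le) (fun x hx => image_eq_zero_of_notMem_tsupport hx)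
      (Eventually.of_forall fun x => ?_)
    rw [tendsto_iff_dist_tendsto_zero]
    refine squeeze_zero (fun _ => dist_nonneg) (fun n => ?_) hel
    rw [dist_comm, Real.dist_eq]
    exact abs_sub_softThreshold_le (he0 n).le f x
  · refine tendsto_eLpNorm_of_dominated hc.isCompact.isBounded (C := (K + K : NNReal))
      (fun n => (measurable_lineDeriv (hcont _)).aestronglyMeasurable)
      (hmeas i).aestronglyMeasurable
      (fun n x => abs_lineDeriv_single_le (LipschitzWith.softThreshold hf (e n)) i x) (hbound i)
      (fun n x hx => lineDeriv_eq_zero_of_notMem_tsupport _ fun h => hx (htsupp n h)) (hzero i)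
      (Eventually.of_forall fun x => ?_)
    by_cases hx : f x = 0
    · simp [hx, lineDeriv_softThreshold_of_eq_zero hf.continuous (he0 _)]
    · simp only [Set.indicator, Set.mem_compl_iff, Set.mem_ofPred_eq, hx, not_false_eq_true,
        if_true]
      refine tendsto_const_nhds.congr' ?_
      filter_upwards [hel.eventually_lt_const (abs_pos.2 hx)] with n hn
      exact (lineDeriv_softThreshold_of_lt hf.continuous (he0 n) _ hn).symm

/-! ### Functions with bounded weak gradient -/

lemma norm_le_of_abs_apply_single_le (L : Pt d →L[ℝ] ℝ) {C : ℝ}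
    (hC : ∀ i, |L (EuclideanSpace.single i 1)| ≤ C) : ‖L‖ ≤ d * |C| := by
  refine L.opNorm_le_bound (by positivity) fun x => ?_
  have hx : x = ∑ i, x i • (EuclideanSpace.single i (1 : ℝ) : Pt d) := by
    simpa using ((EuclideanSpace.basisFun (Fin d) ℝ).sum_repr x).symm
  conv_lhs => rw [hx, map_sum]
  refine (norm_sum_le _ _).trans ?_
  have : ∀ i ∈ Finset.univ, ‖L (x i • (EuclideanSpace.single i (1 : ℝ) : Pt d))‖ ≤
      ‖x‖ * |C| := fun i _ => by
    rw [map_smul, norm_smul]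
    exact mul_le_mul (PiLp.norm_apply_le x i) ((hC i).trans (le_abs_self C)) (abs_nonneg _)
      (norm_nonneg _)
  refine (Finset.sum_le_sum this).trans (le_of_eq ?_)
  simp
  ring

/-- A function with bounded weak gradient on `ℝ^d` has a Lipschitz representative. -/
lemma exists_lipschitz_of_bounded_weakGradient {V : Pt d → ℝ} {G : Fin d → Pt d → ℝ} {C : ℝ}
    (hV : LocallyIntegrable V volume) (hG : ∀ i, ∀ᵐ x, |G i x| ≤ C)
    (hw : ∀ i, ∀ ζ : Pt d → ℝ, ContDiff ℝ ∞ ζ → HasCompactSupport ζ →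
      ∫ x, V x * partialDeriv i ζ x = - ∫ x, G i x * ζ x) :
    ∃ (K : NNReal) (f : Pt d → ℝ), LipschitzWith K f ∧ V =ᵐ[volume] f := by
  set K : NNReal := ⟨d * |C|, by positivity⟩ with hK
  have hlip : ∀ n, LipschitzWith K (mollify n V) := fun n => by
    refine lipschitzWith_of_nnnorm_fderiv_le
      ((contDiff_mollify n hV).differentiable (by simp)) fun x => ?_
    refine norm_le_of_abs_apply_single_le _ fun i => ?_
    have := partialDeriv_mollify n i hV (hw i) x
    rw [partialDeriv] at this
    rw [this]
    exact abs_mollify_le n (hG i) x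
  have hae := ae_tendsto_mollify hV
  -- The mollifications share one Lipschitz constant, so V is Lipschitz on the full-measure set
  -- where they converge to it. The extension theorem for real Lipschitz functions does the rest.
  have hon : LipschitzOnWith K V {x | Tendsto (fun n => mollify n V x) atTop (𝓝 (V x))} := by
    refine LipschitzOnWith.of_dist_le_mul fun x hx y hy => ?_
    exact le_of_tendsto (hx.dist hy) (Eventually.of_forall fun n => (hlip n).dist_le_mul x y)
  obtain ⟨f, hf, hfV⟩ := hon.extend_real
  exact ⟨K, f, hf, hae.mono fun x hx => hfV hx⟩

/-! ### Functions that are Lipschitz on the members of a finite closed cover -/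

/-- Move along the segment from x to y and look at the closed set of times where the Lipschitz bound
from x holds. Such a time t can always be exceeded, using a piece that contains γ(t) and points γ(s)
with s > t arbitrarily near t. The pieces need not be convex; one of them will be the complement of
the domain. -/
lemma lipschitzWith_of_finite_closed_cover {E ι : Type*} [NormedAddCommGroup E] [NormedSpace ℝ E]
    [Finite ι] {A : ι → Set E} (hA : ∀ i, IsClosed (A i)) (hcov : ⋃ i, A i = Set.univ)
    {f : E → ℝ} {K : NNReal} (hf : ∀ i, LipschitzOnWith K f (A i)) : LipschitzWith K f := by
  have hcont : Continuous f :=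
    (locallyFinite_of_finite A).continuous hcov hA fun i => (hf i).continuousOn
  refine LipschitzWith.of_dist_le_mul fun x y => ?_
  set γ : ℝ → E := fun t => AffineMap.lineMap x y t with hγ
  have hγc : Continuous γ := AffineMap.lineMap_continuous
  have hγd : ∀ s t, s ≤ t → dist (γ s) (γ t) = (t - s) * dist x y := fun s t hst => by
    simp only [hγ, dist_lineMap_lineMap]
    rw [dist_comm, Real.dist_eq, abs_of_nonneg (by linarith)]
  set P : Set ℝ := {t | dist (f x) (f (γ t)) ≤ K * (t * dist x y)} with hP
  have hPc : IsClosed P := isClosed_le (by fun_prop) (by fun_prop)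
  have hsub : Set.Icc (0 : ℝ) 1 ⊆ P := by
    refine IsClosed.Icc_subset_of_forall_exists_gt (hPc.inter isClosed_Icc) ?_ ?_
    · simp [hP, hγ]
    · rintro t ⟨htP, ht0, ht1⟩ r hr
      -- Pigeonhole: finitely many pieces cover the points just after t, so one of them recurs.
      have hex : ∃ i, ∃ᶠ s in 𝓝[>] t, γ s ∈ A i := by
        by_contra h
        simp only [not_exists, not_frequently] at h
        obtain ⟨s, hs⟩ := (eventually_all.2 h).exists
        have : γ s ∈ ⋃ i, A i := hcov ▸ Set.mem_univ _
        obtain ⟨i, hi⟩ := Set.mem_iUnion.1 this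
        exact hs i hi
      obtain ⟨i, hi⟩ := hex
      have hti : γ t ∈ A i := by
        rw [← (hA i).closure_eq]
        exact mem_closure_of_frequently_of_tendsto hi
          ((hγc.tendsto t).mono_left nhdsWithin_le_nhds)
      obtain ⟨s, hs, hsr⟩ := (hi.and_eventually (Ioc_mem_nhdsGT hr)).exists
      refine ⟨s, ?_, hsr⟩
      have h1 := (hf i).dist_le_mul _ hti _ hs
      rw [hγd t s hsr.1.le] at h1
      have h2 := dist_triangle (f x) (f (γ t)) (f (γ s))
      simp only [hP, Set.mem_ofPred_eq] at htP ⊢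
      nlinarith
  have := hsub (Set.right_mem_Icc.2 zero_le_one)
  simpa [hP, hγ] using this

/-! ### Polynomials on convex sets -/

lemma exists_lipschitzOnWith_polyVal (q : Poly d) {A : Set (Pt d)} (hA : IsCompact A) :
    ∃ K : NNReal, LipschitzOnWith K (polyVal q) A := by
  have h : LocallyLipschitz (polyVal q) :=
    ((contDiff_polyVal q).of_le (by simp)).locallyLipschitz
  exact LocallyLipschitzOn.exists_lipschitzOnWith_of_compact hA h.locallyLipschitzOn

lemma exists_abs_polyVal_le (q : Poly d) {A : Set (Pt d)} (hA : IsCompact A) :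
    ∃ C, ∀ x ∈ A, |polyVal q x| ≤ C :=
  hA.exists_bound_of_continuousOn (continuous_polyVal q).continuousOn

/-- An open set contains a product of infinite sets of reals, and such a product determines a
polynomial. -/
lemma eq_of_polyVal_eq_on_open {q r : Poly d} {U : Set (Pt d)} (hU : IsOpen U) (hne : U.Nonempty)
    (h : ∀ x ∈ U, polyVal q x = polyVal r x) : q = r := by
  obtain ⟨x₀, hx₀⟩ := hne
  set e := EuclideanSpace.equiv (Fin d) ℝ with he
  have hV : IsOpen (e.symm ⁻¹' U) := hU.preimage e.symm.continuous
  have hmem : e x₀ ∈ e.symm ⁻¹' U := by simpa using hx₀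
  obtain ⟨I, hI, hIV⟩ := isOpen_pi_iff'.1 hV (e x₀) hmem
  refine MvPolynomial.funext_set I (fun i => ?_) fun y hy => ?_
  · exact infinite_of_mem_nhds (e x₀ i) ((hI i).1.mem_nhds (hI i).2)
  · exact h (e.symm y) (hIV hy)

lemma eq_C_of_pderiv_eq_zero {q : Poly d} (h : ∀ i, MvPolynomial.pderiv i q = 0) :
    ∃ c, q = MvPolynomial.C c := by
  have hz : ∀ x, fderiv ℝ (polyVal q) x = 0 := fun x => by
    have : ‖fderiv ℝ (polyVal q) x‖ ≤ d * |(0 : ℝ)| := by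
      refine norm_le_of_abs_apply_single_le _ fun i => ?_
      have := partialDeriv_polyVal i q x
      rw [h i, polyVal_zero, partialDeriv] at this
      simp [this]
    simpa using this
  have hc := is_const_of_fderiv_eq_zero
    (fun x => differentiableAt_polyVal q x) hz
  exact ⟨polyVal q 0, eq_of_polyVal_eq_on_open isOpen_univ Set.univ_nonempty
    fun x _ => by rw [polyVal_C, hc x 0]⟩

/-! ### Simplices -/

lemma isCompact_simplex (K : Finset (Pt d)) : IsCompact (convexHull ℝ (K : Set (Pt d))) :=
  K.finite_toSet.isCompact_convexHull (𝕜 := ℝ)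

lemma isClosed_simplex (K : Finset (Pt d)) : IsClosed (convexHull ℝ (K : Set (Pt d))) :=
  (isCompact_simplex K).isClosed

lemma isOpen_openSimplex (K : Finset (Pt d)) : IsOpen (openSimplex K) := isOpen_interior

lemma openSimplex_subset (K : Finset (Pt d)) : openSimplex K ⊆ convexHull ℝ (K : Set (Pt d)) :=
  interior_subset

lemma isBounded_openSimplex (K : Finset (Pt d)) : Bornology.IsBounded (openSimplex K) :=
  (isCompact_simplex K).isBounded.subset (openSimplex_subset K)

instance (K : Finset (Pt d)) : IsFiniteMeasure (volume.restrict (openSimplex K)) :=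
  ⟨by rw [Measure.restrict_apply_univ]; exact (isBounded_openSimplex K).measure_lt_top⟩

lemma isOpen_domainOf (S : Finset (Finset (Pt d))) : IsOpen (domainOf S) := isOpen_interior

lemma openSimplex_subset_domainOf {S : Finset (Finset (Pt d))} {K : Finset (Pt d)} (hK : K ∈ S) :
    openSimplex K ⊆ domainOf S :=
  interior_mono (Set.subset_biUnion_of_mem (u := fun K : Finset (Pt d) =>
    convexHull ℝ (K : Set (Pt d))) hK)

lemma isCompact_biUnion_simplex (S : Finset (Finset (Pt d))) :
    IsCompact (⋃ K ∈ S, convexHull ℝ (K : Set (Pt d))) :=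
  S.isCompact_biUnion fun K _ => isCompact_simplex K

lemma exists_mem_simplex_of_mem_domainOf {S : Finset (Finset (Pt d))} {x : Pt d}
    (hx : x ∈ domainOf S) : ∃ K ∈ S, x ∈ convexHull ℝ (K : Set (Pt d)) := by
  simpa using interior_subset hx

lemma isBounded_domainOf (S : Finset (Finset (Pt d))) : Bornology.IsBounded (domainOf S) :=
  (isCompact_biUnion_simplex S).isBounded.subset interior_subset

/-- Almost every point of the domain lies in an open simplex. -/
lemma ae_mem_openSimplex (S : Finset (Finset (Pt d))) :
    ∀ᵐ x : Pt d, ∀ K ∈ S, x ∈ convexHull ℝ (K : Set (Pt d)) → x ∈ openSimplex K := by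
  refine (ae_ball_iff S.countable_toSet).2 fun K _ => ?_
  have := (convex_convexHull ℝ (K : Set (Pt d))).addHaar_frontier volume
  filter_upwards [measure_eq_zero_iff_ae_notMem.1 this] with x hx hxK
  by_contra h
  exact hx ⟨subset_closure hxK, h⟩

namespace SimplicialMesh

variable (T : SimplicialMesh d) {K L : Finset (Pt d)}

lemma affineSpan_eq_top (hK : K ∈ T.elements) : affineSpan ℝ (K : Set (Pt d)) = ⊤ := by
  have h := (T.indep K hK).affineSpan_eq_top_iff_card_eq_finrank_add_one
  rw [Subtype.range_coe_subtype] at h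
  refine h.2 ?_
  simp [T.card_eq K hK]

lemma openSimplex_nonempty (hK : K ∈ T.elements) : (openSimplex K).Nonempty :=
  interior_convexHull_nonempty_iff_affineSpan_eq_top.2 (T.affineSpan_eq_top hK)

lemma closure_openSimplex (hK : K ∈ T.elements) :
    closure (openSimplex K) = convexHull ℝ (K : Set (Pt d)) := by
  rw [openSimplex, (convex_convexHull ℝ _).closure_interior_eq_closure_of_nonempty_interior
    (T.openSimplex_nonempty hK), (isClosed_simplex K).closure_eq]

/-- A common interior point makes the intersection full-dimensional. By matching, the intersection
is the hull of the affinely independent set K ∩ L, which therefore has d + 1 points. -/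
lemma eq_of_mem_openSimplex (hK : K ∈ T.elements) (hL : L ∈ T.elements) {x : Pt d}
    (hxK : x ∈ openSimplex K) (hxL : x ∈ openSimplex L) : K = L := by
  classical
  have h1 : (interior (convexHull ℝ ((K ∩ L : Finset (Pt d)) : Set (Pt d)))).Nonempty := by
    refine ⟨x, ?_⟩
    rw [Finset.coe_inter, ← T.matching K hK L hL, interior_inter]
    exact ⟨hxK, hxL⟩
  have h2 := interior_convexHull_nonempty_iff_affineSpan_eq_top.1 h1
  have h3 : AffineIndependent ℝ ((↑) : (K ∩ L : Finset (Pt d)) → Pt d) :=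
    (T.indep K hK).mono (s := ((K ∩ L : Finset (Pt d)) : Set (Pt d))) (by simp)
  have h4 := h3.affineSpan_eq_top_iff_card_eq_finrank_add_one
  rw [Subtype.range_coe_subtype] at h4
  have h5 : (K ∩ L).card = d + 1 := by simpa using h4.1 h2
  have h6 : K ∩ L = K := Finset.eq_of_subset_of_card_le Finset.inter_subset_left
    (by rw [h5, T.card_eq K hK])
  have h7 : K ∩ L = L := Finset.eq_of_subset_of_card_le Finset.inter_subset_right
    (by rw [h5, T.card_eq L hL])
  exact h6.symm.trans h7

lemma brokenFun_eq {S : Finset (Finset (Pt d))} (hS : S ⊆ T.elements) (hK : K ∈ S)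
    (q : Finset (Pt d) → Poly d) {x : Pt d} (hx : x ∈ openSimplex K) :
    brokenFun S q x = polyVal (q K) x := by
  rw [brokenFun, Finset.sum_eq_single_of_mem K hK, Set.indicator_of_mem hx]
  intro L hL hne
  exact Set.indicator_of_notMem
    (fun h => hne (T.eq_of_mem_openSimplex (hS hL) (hS hK) h hx)) _

end SimplicialMesh

lemma brokenFun_eq_zero {S : Finset (Finset (Pt d))} (q : Finset (Pt d) → Poly d) {x : Pt d}
    (hx : ∀ K ∈ S, x ∉ openSimplex K) : brokenFun S q x = 0 :=
  Finset.sum_eq_zero fun K hK => Set.indicator_of_notMem (hx K hK) _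

/-! ### Uniqueness of weak gradients -/

/-- The fundamental lemma of the calculus of variations, applied to G i - ∂ᵢq. It identifies the
gradients that `MemH10` and `IsLocalBest` only assert to exist. -/
lemma ae_eq_pderiv_of_weakGradient {U : Set (Pt d)} (hU : IsOpen U) {v : Pt d → ℝ}
    {G : Fin d → Pt d → ℝ} (hG : ∀ i, MemLp (G i) 2 (volume.restrict U))
    (hw : ∀ φ, IsTest U φ → ∀ i, ∫ x in U, v x * partialDeriv i φ x = - ∫ x in U, G i x * φ x)
    {q : Poly d} (hv : v =ᵐ[volume.restrict U] polyVal q) (i : Fin d) :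
    G i =ᵐ[volume.restrict U] polyVal (MvPolynomial.pderiv i q) := by
  have hGl : LocallyIntegrable (G i) (volume.restrict U) := (hG i).locallyIntegrable (by norm_num)
  have hpl : LocallyIntegrable (polyVal (MvPolynomial.pderiv i q)) (volume.restrict U) :=
    (continuous_polyVal _).locallyIntegrable
  have hl : LocallyIntegrableOn (fun x => G i x - polyVal (MvPolynomial.pderiv i q) x) U volume :=
    locallyIntegrableOn_of_locallyIntegrable_restrict (hGl.sub hpl)
  have h := hU.ae_eq_zero_of_integral_contDiff_smul_eq_zero hl fun g hg hgc hgU => by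
    have hg0 : ∀ x ∉ U, g x = 0 := fun x hx =>
      image_eq_zero_of_notMem_tsupport fun h => hx (hgU h)
    have h1 := hw g ⟨hg, hgc, hgU⟩ i
    have h2 : ∫ x in U, v x * partialDeriv i g x = ∫ x in U, polyVal q x * partialDeriv i g x :=
      integral_congr_ae (hv.mono fun x hx => by simp [hx])
    have h3 : ∫ x in U, polyVal q x * partialDeriv i g x = ∫ x, polyVal q x * partialDeriv i g x :=
      setIntegral_eq_integral_of_forall_compl_eq_zero fun x hx => by
        rw [partialDeriv_eq_zero i fun h => hx (hgU h), mul_zero]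
    have h4 := integral_mul_partialDeriv (contDiff_polyVal q) hg hgc i
    simp only [partialDeriv_polyVal] at h4
    have h5 : ∫ x, polyVal (MvPolynomial.pderiv i q) x * g x =
        ∫ x in U, polyVal (MvPolynomial.pderiv i q) x * g x :=
      (setIntegral_eq_integral_of_forall_compl_eq_zero fun x hx => by rw [hg0 x hx, mul_zero]).symm
    have h6 : ∫ x, g x • (G i x - polyVal (MvPolynomial.pderiv i q) x) =
        ∫ x in U, (G i x * g x - polyVal (MvPolynomial.pderiv i q) x * g x) := by
      rw [setIntegral_eq_integral_of_forall_compl_eq_zero fun x hx => by rw [hg0 x hx]; ring]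
      congr 1
      ext x
      simp only [smul_eq_mul]
      ring
    have i1 : Integrable (fun x => G i x * g x) (volume.restrict U) :=
      (hG i).integrable_mul (memLp_of_contDiff hg.continuous hgc U)
    have i2 : Integrable (fun x => polyVal (MvPolynomial.pderiv i q) x * g x)
        (volume.restrict U) :=
      (((continuous_polyVal _).mul hg.continuous).integrable_of_hasCompactSupport
        hgc.mul_left).restrict
    rw [h6, integral_sub i1 i2]
    linarith
  rw [EventuallyEq, ae_restrict_iff' hU.measurableSet]
  exact h.mono fun x hx hxU => sub_eq_zero.1 (hx hxU)

lemma memLp_polyVal (q : Poly d) (K : Finset (Pt d)) :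
    MemLp (polyVal q) 2 (volume.restrict (openSimplex K)) := by
  obtain ⟨C, hC⟩ := exists_abs_polyVal_le q (isCompact_simplex K)
  refine MemLp.of_bound (continuous_polyVal q).aestronglyMeasurable C ?_
  rw [ae_restrict_iff' (isOpen_openSimplex K).measurableSet]
  exact Eventually.of_forall fun x hx => hC x (openSimplex_subset K hx)

lemma hasH1Grad_of_ae_eq_polyVal {K : Finset (Pt d)} {v : Pt d → ℝ} {q : Poly d}
    (hv : v =ᵐ[volume.restrict (openSimplex K)] polyVal q) :
    HasH1Grad (openSimplex K) v (fun i => polyVal (MvPolynomial.pderiv i q)) := by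
  refine ⟨(memLp_polyVal q K).ae_eq hv.symm, fun i => memLp_polyVal _ K, fun φ hφ i => ?_⟩
  have h2 : ∫ x in openSimplex K, v x * partialDeriv i φ x =
      ∫ x in openSimplex K, polyVal q x * partialDeriv i φ x :=
    integral_congr_ae (hv.mono fun x hx => by simp [hx])
  rw [h2, setIntegral_eq_integral_of_forall_compl_eq_zero fun x hx => by
      rw [hφ.partialDeriv_eq_zero i hx, mul_zero],
    setIntegral_eq_integral_of_forall_compl_eq_zero fun x hx => by rw [hφ.eq_zero hx, mul_zero],
    integral_mul_partialDeriv (contDiff_polyVal q) hφ.1 hφ.2.1 i]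
  simp only [partialDeriv_polyVal]

/-! ### Continuity of conforming piecewise polynomials -/

namespace SimplicialMesh

variable (T : SimplicialMesh d)

/-- A piecewise polynomial with vanishing trace is, up to a null set, a Lipschitz function on
`ℝ^d` which vanishes off the domain. -/
lemma exists_lipschitz_of_memH10 {q : Finset (Pt d) → Poly d}
    (h : MemH10 T.domain (brokenFun T.elements q)) :
    ∃ (C : NNReal) (f : Pt d → ℝ), LipschitzWith C f ∧
      (∀ K ∈ T.elements, ∀ x ∈ convexHull ℝ (K : Set (Pt d)), f x = polyVal (q K) x) ∧
      ∀ x ∉ T.domain, f x = 0 := by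
  obtain ⟨G, hG⟩ := memH10_iff.1 h
  set V := brokenFun T.elements q with hV
  have hWo : IsOpen T.domain := isOpen_domainOf _
  have hV0 : ∀ x ∉ T.domain, V x = 0 := fun x hx =>
    brokenFun_eq_zero q fun K hK hxK => hx (openSimplex_subset_domainOf hK hxK)
  have hext := hG.extend hWo.measurableSet (Set.subset_univ _)
  rw [Set.indicator_eq_self.2 fun x hx => by_contra fun h => hx (hV0 x h)] at hext
  have hVl : LocallyIntegrable V volume := by
    have := hext.1.locallyIntegrable (by norm_num)
    rwa [Measure.restrict_univ] at this
  -- A test function supported in one open simplex sees only the polynomial of that simplex.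
  have hgrad : ∀ i, ∀ K ∈ T.elements, ∀ᵐ x, x ∈ openSimplex K →
      G i x = polyVal (MvPolynomial.pderiv i (q K)) x := by
    intro i K hK
    rw [← ae_restrict_iff' (isOpen_openSimplex K).measurableSet]
    have hsub := openSimplex_subset_domainOf hK
    refine ae_eq_pderiv_of_weakGradient (v := V) (isOpen_openSimplex K)
      (fun i => (hG.2.1 i).mono_measure (Measure.restrict_mono hsub le_rfl)) (fun φ hφ i => ?_) ?_ i
    · have hφ0 : ∀ x ∉ openSimplex K, φ x = 0 := fun x hx => hφ.eq_zero hx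
      have := hG.integral_mul_partialDeriv hφ.1 hφ.2.1 i
      rw [setIntegral_eq_integral_of_forall_compl_eq_zero fun x hx => by
          rw [hV0 x hx, zero_mul],
        setIntegral_eq_integral_of_forall_compl_eq_zero fun x hx => by
          rw [hφ.eq_zero fun h => hx (hsub h), mul_zero]] at this
      rw [setIntegral_eq_integral_of_forall_compl_eq_zero fun x hx => by
          rw [hφ.partialDeriv_eq_zero i hx, mul_zero],
        setIntegral_eq_integral_of_forall_compl_eq_zero fun x hx => by
          rw [hφ.eq_zero hx, mul_zero]]
      exact this
    · rw [EventuallyEq, ae_restrict_iff' (isOpen_openSimplex K).measurableSet]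
      exact Eventually.of_forall fun x hx => T.brokenFun_eq (Finset.Subset.refl _) hK q hx
  have hbound : ∃ C, ∀ i, ∀ K ∈ T.elements, ∀ x ∈ openSimplex K,
      |polyVal (MvPolynomial.pderiv i (q K)) x| ≤ C := by
    choose C hC using fun (i : Fin d) (K : Finset (Pt d)) =>
      exists_abs_polyVal_le (MvPolynomial.pderiv i (q K)) (isCompact_simplex K)
    refine ⟨∑ i, ∑ K ∈ T.elements, |C i K|, fun i K hK x hx => ?_⟩
    refine (hC i K x (openSimplex_subset K hx)).trans ((le_abs_self _).trans ?_)
    refine (Finset.single_le_sum (f := fun K => |C i K|) (fun _ _ => abs_nonneg _) hK).trans ?_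
    exact Finset.single_le_sum (f := fun i => ∑ K ∈ T.elements, |C i K|)
      (fun _ _ => Finset.sum_nonneg fun _ _ => abs_nonneg _) (Finset.mem_univ i)
  obtain ⟨C, hC⟩ := hbound
  obtain ⟨M, f, hf, hVf⟩ := exists_lipschitz_of_bounded_weakGradient (C := |C|) hVl
    (G := fun i => T.domain.indicator (G i)) (fun i => by
      filter_upwards [ae_mem_openSimplex T.elements,
        (ae_ball_iff T.elements.countable_toSet).2 (hgrad i)] with x hx hgx
      by_cases hxW : x ∈ T.domain
      · obtain ⟨K, hK, hxK⟩ := exists_mem_simplex_of_mem_domainOf hxW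
        rw [Set.indicator_of_mem hxW, hgx K hK (hx K hK hxK)]
        exact (hC i K hK x (hx K hK hxK)).trans (le_abs_self C)
      · simp [hxW])
    (fun i ζ hζ hζc => by
      have := hext.integral_mul_partialDeriv hζ hζc i
      rwa [Measure.restrict_univ] at this)
  refine ⟨M, f, hf, fun K hK => ?_, ?_⟩
  · have h1 : Set.EqOn f (polyVal (q K)) (openSimplex K) := by
      refine Measure.eqOn_open_of_ae_eq (μ := volume) ?_ (isOpen_openSimplex K)
        hf.continuous.continuousOn (continuous_polyVal _).continuousOn
      rw [EventuallyEq, ae_restrict_iff' (isOpen_openSimplex K).measurableSet]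
      filter_upwards [hVf] with x hx hxK
      rw [← hx]
      exact T.brokenFun_eq (Finset.Subset.refl _) hK q hxK
    rw [← T.closure_openSimplex hK]
    exact h1.closure hf.continuous (continuous_polyVal _)
  · set A := ⋃ K ∈ T.elements, convexHull ℝ (K : Set (Pt d)) with hA
    have hAo : IsOpen Aᶜ := (isCompact_biUnion_simplex _).isClosed.isOpen_compl
    have h1 : Set.EqOn f (fun _ => 0) Aᶜ := by
      refine Measure.eqOn_open_of_ae_eq (μ := volume) ?_ hAo
        hf.continuous.continuousOn continuousOn_const
      rw [EventuallyEq, ae_restrict_iff' hAo.measurableSet]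
      filter_upwards [hVf] with x hx hxA
      rw [← hx]
      exact hV0 x fun h => hxA (interior_subset h)
    -- f vanishes on the open exterior of the closed union. By continuity it vanishes on the closure
    -- of that exterior, which is the complement of the interior.
    have h2 := h1.closure hf.continuous continuous_const
    intro x hx
    refine h2 ?_
    rw [closure_compl]
    exact hx

/-- The closed simplices together with the complement of the domain (index `none`) form a finite
closed cover of ℝ^d. -/
lemma lipschitz_of_eq_polyVal {q : Finset (Pt d) → Poly d} {f : Pt d → ℝ}
    (hf : ∀ K ∈ T.elements, ∀ x ∈ convexHull ℝ (K : Set (Pt d)), f x = polyVal (q K) x)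
    (hf0 : ∀ x ∉ T.domain, f x = 0) {C : NNReal}
    (hq : ∀ K ∈ T.elements, LipschitzOnWith C (polyVal (q K)) (convexHull ℝ (K : Set (Pt d)))) :
    LipschitzWith C f := by
  let A : Option T.elements → Set (Pt d) := fun o =>
    o.elim T.domainᶜ fun K => convexHull ℝ (K.1 : Set (Pt d))
  refine lipschitzWith_of_finite_closed_cover (A := A) ?_ ?_ ?_
  · rintro (_ | K)
    · exact (isOpen_domainOf _).isClosed_compl
    · exact isClosed_simplex _
  · rw [Set.eq_univ_iff_forall]
    intro x
    rw [Set.mem_iUnion]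
    by_cases hx : x ∈ T.domain
    · obtain ⟨K, hK, hxK⟩ := exists_mem_simplex_of_mem_domainOf hx
      exact ⟨some ⟨K, hK⟩, hxK⟩
    · exact ⟨none, hx⟩
  · rintro (_ | ⟨K, hK⟩) x hx y hy
    · simp [hf0 x hx, hf0 y hy]
    · rw [hf K hK x hx, hf K hK y hy]
      exact hq K hK hx hy

/-- A piecewise polynomial which is single valued on the closed simplices and vanishes off the
domain has vanishing trace. -/
lemma memH10_of_eq_polyVal {q : Finset (Pt d) → Poly d} {f : Pt d → ℝ}
    (hf : ∀ K ∈ T.elements, ∀ x ∈ convexHull ℝ (K : Set (Pt d)), f x = polyVal (q K) x)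
    (hf0 : ∀ x ∉ T.domain, f x = 0) : MemH10 T.domain (brokenFun T.elements q) := by
  choose C hC using fun K : Finset (Pt d) =>
    exists_lipschitzOnWith_polyVal (q K) (isCompact_simplex K)
  have hlip : LipschitzWith (∑ K ∈ T.elements, C K) f :=
    T.lipschitz_of_eq_polyVal hf hf0 fun K hK =>
      (hC K).weaken (Finset.single_le_sum (f := C) (fun _ _ => zero_le) hK)
  have hc : HasCompactSupport f := by
    refine HasCompactSupport.of_support_subset_isCompact
      (isCompact_biUnion_simplex T.elements) fun x hx => ?_
    by_contra h
    exact hx (hf0 x fun h' => h (interior_subset h'))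
  refine (MemH10.of_lipschitz (isOpen_domainOf _) hlip hc hf0).congr ?_
  rw [EventuallyEq, ae_restrict_iff' (isOpen_domainOf _).measurableSet]
  filter_upwards [ae_mem_openSimplex T.elements] with x hx hxW
  obtain ⟨K, hK, hxK⟩ := exists_mem_simplex_of_mem_domainOf hxW
  rw [hf K hK x hxK, T.brokenFun_eq (Finset.Subset.refl _) hK q (hx K hK hxK)]

end SimplicialMesh

/-! ### Interpolation of polynomials on the integer points of a simplex -/

/-- The polynomial functions of degree at most `n`, as sums of products of `n` affine functions. -/
inductive IsPolyFun {ι : Type*} [Fintype ι] : ℕ → ((ι → ℝ) → ℝ) → Prop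
  | const (c : ℝ) : IsPolyFun 0 fun _ => c
  | mul_affine {n : ℕ} (a : ℝ) (c : ι → ℝ) {g : (ι → ℝ) → ℝ} (hg : IsPolyFun n g) :
      IsPolyFun (n + 1) fun t => (a + ∑ b, c b * t b) * g t
  | add {n : ℕ} {f g : (ι → ℝ) → ℝ} (hf : IsPolyFun n f) (hg : IsPolyFun n g) :
      IsPolyFun n fun t => f t + g t

namespace IsPolyFun

variable {ι : Type*} [Fintype ι]

lemma congr {n : ℕ} {f g : (ι → ℝ) → ℝ} (hf : IsPolyFun n f) (h : ∀ t, f t = g t) :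
    IsPolyFun n g := (funext h : f = g) ▸ hf

lemma succ {n : ℕ} {f : (ι → ℝ) → ℝ} (hf : IsPolyFun n f) : IsPolyFun (n + 1) f :=
  (mul_affine 1 0 hf).congr fun t => by simp

lemma mono {n m : ℕ} (hnm : n ≤ m) {f : (ι → ℝ) → ℝ} (hf : IsPolyFun n f) : IsPolyFun m f := by
  induction hnm with
  | refl => exact hf
  | step _ ih => exact ih.succ

lemma const_mul {n : ℕ} {f : (ι → ℝ) → ℝ} (k : ℝ) (hf : IsPolyFun n f) :
    IsPolyFun n fun t => k * f t := by
  induction hf with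
  | const c => exact const (k * c)
  | mul_affine a c _ ih => exact (mul_affine a c ih).congr fun t => by ring
  | add _ _ ihf ihg => exact (add ihf ihg).congr fun t => by ring

lemma mul {n m : ℕ} {f g : (ι → ℝ) → ℝ} (hf : IsPolyFun n f) (hg : IsPolyFun m g) :
    IsPolyFun (n + m) fun t => f t * g t := by
  induction hf with
  | const c => exact (hg.const_mul c).mono (by omega)
  | @mul_affine n a c _ _ ih =>
    have := (mul_affine a c ih).congr (g := fun t => _) fun t => (mul_assoc _ _ _).symm
    rwa [show n + 1 + m = n + m + 1 by omega]
  | add _ _ ihf ihg => exact (add ihf ihg).congr fun t => by ring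

lemma pow {n : ℕ} {f : (ι → ℝ) → ℝ} (hf : IsPolyFun n f) (k : ℕ) :
    IsPolyFun (k * n) fun t => f t ^ k := by
  induction k with
  | zero => simpa using const (ι := ι) 1
  | succ k ih => simpa only [pow_succ, Nat.succ_mul] using! ih.mul hf

lemma prod {κ : Type*} (s : Finset κ) {n : κ → ℕ} {f : κ → (ι → ℝ) → ℝ}
    (hf : ∀ i ∈ s, IsPolyFun (n i) (f i)) :
    IsPolyFun (∑ i ∈ s, n i) fun t => ∏ i ∈ s, f i t := by
  classical
  induction s using Finset.induction_on with
  | empty => simpa using const (ι := ι) 1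
  | insert a s ha ih =>
    simp only [Finset.sum_insert ha, Finset.prod_insert ha]
    exact (hf a (by simp)).mul (ih fun i hi => hf i (by simp [hi]))

lemma sum {κ : Type*} (s : Finset κ) {n : ℕ} {f : κ → (ι → ℝ) → ℝ}
    (hf : ∀ i ∈ s, IsPolyFun n (f i)) : IsPolyFun n fun t => ∑ i ∈ s, f i t := by
  classical
  induction s using Finset.induction_on with
  | empty => simpa using (const (ι := ι) 0).mono (Nat.zero_le n)
  | insert a s ha ih =>
    simp only [Finset.sum_insert ha]
    exact (hf a (by simp)).add (ih fun i hi => hf i (by simp [hi]))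

end IsPolyFun

/-- The binomial coefficient `t (t - 1) ⋯ (t - k + 1) / k!`. -/
noncomputable def binom (t : ℝ) (k : ℕ) : ℝ := (∏ j ∈ Finset.range k, (t - j)) / k.factorial

lemma succ_mul_binom_succ (t : ℝ) (k : ℕ) :
    ((k : ℝ) + 1) * binom t (k + 1) = t * binom (t - 1) k := by
  have hk : (k.factorial : ℝ) ≠ 0 := by positivity
  have h : ∏ j ∈ Finset.range k, (t - ((j + 1 : ℕ) : ℝ)) =
      ∏ j ∈ Finset.range k, (t - 1 - j) :=
    Finset.prod_congr rfl fun j _ => by push_cast; ring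
  rw [binom, binom, Finset.prod_range_succ', h, Nat.factorial_succ]
  push_cast
  field_simp
  ring

lemma binom_natCast (n k : ℕ) : binom n k = n.choose k := by
  induction k generalizing n with
  | zero => simp [binom]
  | succ k ih =>
    have hk : (k : ℝ) + 1 ≠ 0 := by positivity
    refine mul_left_cancel₀ hk ?_
    rw [succ_mul_binom_succ]
    cases n with
    | zero => simp
    | succ n =>
      have := Nat.add_one_mul_choose_eq n k
      rw [show ((n + 1 : ℕ) : ℝ) - 1 = n by push_cast; ring, ih]
      have h2 : ((n + 1 : ℕ) : ℝ) * n.choose k = (n + 1).choose (k + 1) * ((k : ℝ) + 1) := by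
        exact_mod_cast this
      rw [h2, mul_comm]

/-- The absorption identity (k + 1)·C(t, k + 1) = t·C(t - 1, k) in the coordinate b, with the
reindexing α ↦ α + e_b; terms with α_b = 0 vanish. It drives the induction in `IsPolyFun.sum_binom`.
-/
lemma sum_mul_prod_binom {ι : Type*} [Fintype ι] [DecidableEq ι] (n : ℕ) (g : (ι → ℝ) → ℝ)
    (t : ι → ℝ) (b : ι) :
    ∑ α ∈ Finset.piAntidiag Finset.univ (n + 1),
        (α b : ℝ) * g (fun i => α i) * ∏ i, binom (t i) (α i) =
      t b * ∑ α ∈ Finset.piAntidiag Finset.univ n,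
        g (fun i => α i + (Pi.single b 1 : ι → ℝ) i) *
          ∏ i, binom ((t - (Pi.single b 1 : ι → ℝ)) i) (α i) := by
  rw [Finset.mul_sum]
  symm
  refine Finset.sum_of_injOn (fun α => α + (Pi.single b 1 : ι → ℕ)) (fun x _ y _ h => by simpa using h)
    (fun α hα => ?_) (fun α hα hα' => ?_) fun α _ => ?_
  · simp only [Finset.mem_coe, Finset.mem_univ, implies_true, and_true,
      Finset.mem_piAntidiag] at hα ⊢
    simp [Finset.sum_add_distrib, hα]
  · have : α b = 0 := by
      by_contra h
      refine hα' ⟨α - (Pi.single b 1 : ι → ℕ), ?_, ?_⟩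
      · simp only [Finset.mem_coe, Finset.mem_piAntidiag, Finset.mem_univ, implies_true,
          and_true] at hα ⊢
        have h1 : (Pi.single b 1 : ι → ℕ) ≤ α := by
          intro i
          by_cases hi : i = b
          · subst hi; simp; omega
          · simp [hi]
        have h2 : ∑ i, (α - (Pi.single b 1 : ι → ℕ) + (Pi.single b 1 : ι → ℕ)) i = n + 1 := by
          rw [tsub_add_cancel_of_le h1, hα]
        simpa [Finset.sum_add_distrib] using h2
      · ext i
        by_cases hi : i = b
        · subst hi; simp; omega
        · simp [hi]
    simp [this]
  · have h1 : ∏ i, binom (t i) ((α + (Pi.single b 1 : ι → ℕ)) i) =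
        binom (t b) (α b + 1) * ∏ i ∈ Finset.univ.erase b, binom (t i) (α i) := by
      rw [← Finset.mul_prod_erase Finset.univ _ (Finset.mem_univ b)]
      congr 1
      · simp
      · exact Finset.prod_congr rfl fun i hi => by simp [Finset.ne_of_mem_erase hi]
    have h2 : ∏ i, binom ((t - (Pi.single b 1 : ι → ℝ)) i) (α i) =
        binom (t b - 1) (α b) * ∏ i ∈ Finset.univ.erase b, binom (t i) (α i) := by
      rw [← Finset.mul_prod_erase Finset.univ _ (Finset.mem_univ b)]
      congr 1
      · simp
      · exact Finset.prod_congr rfl fun i hi => by simp [Finset.ne_of_mem_erase hi]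
    have h3 : (fun i => (((α + (Pi.single b 1 : ι → ℕ)) i : ℕ) : ℝ)) =
        fun i => (α i : ℝ) + (Pi.single b 1 : ι → ℝ) i := by
      ext i
      by_cases hi : i = b
      · subst hi; simp
      · simp [hi]
    simp only [h1, h2, h3]
    have := succ_mul_binom_succ (t b) (α b)
    simp only [Pi.add_apply, Pi.single_eq_same]
    push_cast
    linear_combination (-(g (fun i => (α i : ℝ) + (Pi.single b 1 : ι → ℝ) i)) *
      ∏ i ∈ Finset.univ.erase b, binom (t i) (α i)) * this

/-- On the hyperplane `∑ t = n`, a polynomial function of degree at most `n` is determined by its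
values at the points with natural coordinates. -/
lemma IsPolyFun.sum_binom {ι : Type*} [Fintype ι] [DecidableEq ι] {n : ℕ} {f : (ι → ℝ) → ℝ}
    (hf : IsPolyFun n f) (v t : ι → ℝ) (ht : ∑ b, t b = n) :
    ∑ α ∈ Finset.piAntidiag Finset.univ n, f (fun i => α i + v i) * ∏ i, binom (t i) (α i) =
      f (fun i => t i + v i) := by
  induction hf generalizing v t with
  | const c => simp [binom]
  | add _ _ ihf ihg => simp only [add_mul, Finset.sum_add_distrib, ihf v t ht, ihg v t ht]
  | @mul_affine n a c g hg ih =>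
    -- Homogenisation: on the hyperplane where the coordinates sum to n + 1, the constant part of
    -- the affine factor, shift included, is spread evenly over the coordinates. The factor becomes
    -- the linear form with coefficients k.
    set k : ι → ℝ := fun b => c b + (a + ∑ i, c i * v i) / (n + 1) with hk
    have hn : (n : ℝ) + 1 ≠ 0 := by positivity
    have key : ∀ s : ι → ℝ, ∑ b, s b = n + 1 →
        a + ∑ b, c b * (s b + v b) = ∑ b, k b * s b := by
      intro s hs
      simp only [hk, add_mul, mul_add, Finset.sum_add_distrib, ← Finset.mul_sum, hs]
      field_simp
      ring
    have ht' : ∑ b, t b = n + 1 := by rw [ht]; push_cast; ring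
    calc _ = ∑ α ∈ Finset.piAntidiag Finset.univ (n + 1), ∑ b, k b * ((α b : ℝ) *
          (fun s : ι → ℝ => g (fun i => s i + v i)) (fun i => α i) * ∏ i, binom (t i) (α i)) := by
          refine Finset.sum_congr rfl fun α hα => ?_
          have hα' : ∑ b, (α b : ℝ) = n + 1 := by
            have := (Finset.mem_piAntidiag.1 hα).1
            exact_mod_cast this
          simp only []
          rw [key _ hα', Finset.sum_mul, Finset.sum_mul]
          exact Finset.sum_congr rfl fun b _ => by ring
      _ = ∑ b, k b * (t b * g (fun i => t i + v i)) := by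
          rw [Finset.sum_comm]
          refine Finset.sum_congr rfl fun b _ => ?_
          rw [← Finset.mul_sum, sum_mul_prod_binom n
            (fun s : ι → ℝ => g (fun i => s i + v i)) t b]
          -- The statement carries a shift v for this step: e_b is subtracted from t, whose sum
          -- drops to n, and added to v.
          have := ih (fun i => (Pi.single b 1 : ι → ℝ) i + v i) (t - (Pi.single b 1 : ι → ℝ)) (by
            simp [Finset.sum_sub_distrib, ht'])
          simp only [← add_assoc] at this
          rw [this]
          simp
      _ = _ := by
          simp only [key t ht', Finset.sum_mul]
          exact Finset.sum_congr rfl fun b _ => by ring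

/-! ### Unisolvence of the Lagrange nodes -/

lemma isPolyFun_polyVal {ι : Type*} [Fintype ι] (e : ι → Pt d) {p : ℕ} {r : Poly d}
    (hr : r.totalDegree ≤ p) : IsPolyFun p fun t : ι → ℝ => polyVal r (∑ b, t b • e b) := by
  simp only [polyVal, MvPolynomial.eval_eq']
  refine IsPolyFun.sum _ fun m hm => IsPolyFun.const_mul _ ?_
  have hdeg : ∑ i, m i * 1 ≤ p := by
    simp only [mul_one]
    refine le_trans (le_of_eq ?_) ((MvPolynomial.le_totalDegree hm).trans hr)
    rw [Finsupp.sum_fintype]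
    simp
  refine (IsPolyFun.prod Finset.univ fun i _ => IsPolyFun.pow ?_ (m i)).mono hdeg
  refine (IsPolyFun.mul_affine 0 (fun b => e b i) (IsPolyFun.const 1)).congr fun t => ?_
  simp [mul_comm]

/-- `IsPolyFun.sum_binom` at t = p·w, for the points b/p, writes the value of r as a combination of
its nodal values. No affine independence is involved and σ is arbitrary, so this applies to faces of
every dimension. -/
lemma polyVal_eq_zero_of_lagrangeNodes {σ : Finset (Pt d)} {p : ℕ} (hp : 1 ≤ p) {r : Poly d}
    (hr : r.totalDegree ≤ p) (h : ∀ x ∈ lagrangeNodes σ p, polyVal r x = 0) {w : Pt d → ℝ}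
    (hw : ∑ b ∈ σ, w b = 1) : polyVal r (∑ b ∈ σ, w b • b) = 0 := by
  classical
  have hp0 : (p : ℝ) ≠ 0 := by positivity
  have key := (isPolyFun_polyVal (fun b : σ => (1 / (p : ℝ)) • (b : Pt d)) hr).sum_binom 0
    (fun b => p * w b) (by
      rw [← Finset.mul_sum, Finset.sum_coe_sort σ w, hw, mul_one])
  simp only [Pi.zero_apply, add_zero, smul_smul] at key
  have h1 : ∑ b : σ, ((p : ℝ) * w b * (1 / p)) • (b : Pt d) = ∑ b ∈ σ, w b • b := by
    rw [← Finset.sum_coe_sort σ fun b => w b • b]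
    refine Finset.sum_congr rfl fun b _ => ?_
    congr 1
    field_simp
  rw [h1] at key
  rw [← key]
  refine Finset.sum_eq_zero fun α hα => ?_
  rw [h _ ?_, zero_mul]
  refine ⟨fun b => if hb : b ∈ σ then α ⟨b, hb⟩ else 0, ?_, ?_⟩
  · rw [← Finset.sum_coe_sort σ]
    simpa using (Finset.mem_piAntidiag.1 hα).1
  · rw [← Finset.sum_coe_sort σ]
    refine Finset.sum_congr rfl fun b _ => ?_
    simp [div_eq_mul_inv]

/-! ### Hat functions -/

lemma polyVal_sum_smul_of_totalDegree_le_one {σ : Finset (Pt d)} {r : Poly d}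
    (hr : r.totalDegree ≤ 1) {w : Pt d → ℝ} (hw : ∑ b ∈ σ, w b = 1) :
    polyVal r (∑ b ∈ σ, w b • b) = ∑ b ∈ σ, w b * polyVal r b := by
  simp only [polyVal, MvPolynomial.eval_eq', Finset.mul_sum]
  rw [Finset.sum_comm]
  refine Finset.sum_congr rfl fun m hm => ?_
  have hdeg : m.degree ≤ 1 := by
    refine le_trans (le_of_eq ?_) ((MvPolynomial.le_totalDegree hm).trans hr)
    rfl
  rcases Nat.le_one_iff_eq_zero_or_eq_one.1 hdeg with h | h
  · have : m = 0 := (Finsupp.degree_eq_zero_iff m).1 h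
    subst this
    simp [← Finset.sum_mul, hw]
  · obtain ⟨i, rfl⟩ : m ∈ Set.range fun i => Finsupp.single i 1 := by
      rw [Finsupp.range_single_one]
      exact h
    have hprod : ∀ x : Pt d, ∏ j, x j ^ (Finsupp.single i 1) j = x i := fun x => by
      rw [Finset.prod_eq_single i] <;> simp +contextual [eq_comm]
    simp only [hprod]
    simp [Finset.mul_sum, mul_left_comm]

namespace SimplicialMesh

variable (T : SimplicialMesh d) {K : Finset (Pt d)}

lemma exists_isHat (hK : K ∈ T.elements) (a : Pt d) : ∃ r, IsHat a K r := by
  classical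
  by_cases ha : a ∈ K
  swap
  · exact ⟨0, by simp, fun b hb => by
      rw [polyVal_zero, if_neg (by rintro rfl; exact ha hb)]⟩
  have htop : affineSpan ℝ (Set.range ((↑) : K → Pt d)) = ⊤ := by
    rw [Subtype.range_coe_subtype]
    exact T.affineSpan_eq_top hK
  let B : AffineBasis K ℝ (Pt d) := ⟨_, T.indep K hK, htop⟩
  set A := B.coord ⟨a, ha⟩ with hA
  set r : Poly d := MvPolynomial.C (A 0) +
    ∑ i, MvPolynomial.C (A.linear (EuclideanSpace.single i 1)) * MvPolynomial.X i with hr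
  have hval : ∀ x, polyVal r x = A x := by
    intro x
    have hx : x = ∑ i, x i • (EuclideanSpace.single i (1 : ℝ) : Pt d) := by
      simpa using ((EuclideanSpace.basisFun (Fin d) ℝ).sum_repr x).symm
    have h1 : A x = A.linear x + A 0 := by
      have := A.map_vadd 0 x
      simpa using this
    rw [h1]
    conv_rhs => rw [hx, map_sum]
    simp only [hr, polyVal_add, polyVal_C, polyVal_sum, polyVal_mul, polyVal_X, map_smul,
      smul_eq_mul, mul_comm]
    ring
  refine ⟨r, ?_, fun b hb => ?_⟩
  · refine (MvPolynomial.totalDegree_add _ _).trans (max_le (by simp) ?_)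
    refine MvPolynomial.totalDegree_finsetSum_le fun i _ => ?_
    exact (MvPolynomial.totalDegree_mul _ _).trans (by simp)
  · rw [hval]
    have := B.coord_apply ⟨a, ha⟩ ⟨b, hb⟩
    rw [hA]
    refine this.trans ?_
    simp [eq_comm]

lemma isHat_hat (hK : K ∈ T.elements) (a : Pt d) : IsHat a K (hat a K) :=
  Classical.epsilon_spec (T.exists_isHat hK a)

open Classical in
lemma polyVal_hat (hK : K ∈ T.elements) (a : Pt d) {w : Pt d → ℝ} (hw : ∑ b ∈ K, w b = 1) :
    polyVal (hat a K) (∑ b ∈ K, w b • b) = if a ∈ K then w a else 0 := by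
  obtain ⟨h1, h2⟩ := T.isHat_hat hK a
  rw [polyVal_sum_smul_of_totalDegree_le_one h1 hw, Finset.sum_congr rfl fun b hb => by rw [h2 b hb]]
  simp

/-! ### Lagrange interpolation -/

/-- With barycentric coordinates λ, the basis function of the node β/p is ∏ C(pλ_b, β_b). At the
node α/p it equals ∏ C(α_b, β_b). This is 1 for α = β; otherwise the equal sums force some β_b > α_b
and the product is 0. -/
lemma exists_isLagrangeInterp (hK : K ∈ T.elements) {p : ℕ} (hp : 1 ≤ p) (w : Poly d) :
    ∃ r, IsLagrangeInterp K p w r := by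
  classical
  have hp0 : (p : ℝ) ≠ 0 := by positivity
  set B : Pt d → ℕ → Poly d := fun b k =>
    MvPolynomial.C (1 / (k.factorial : ℝ)) *
      ∏ j ∈ Finset.range k, (MvPolynomial.C (p : ℝ) * hat b K - MvPolynomial.C (j : ℝ)) with hB
  have hBdeg : ∀ b k, (B b k).totalDegree ≤ k := fun b k => by
    refine (MvPolynomial.totalDegree_mul _ _).trans ?_
    rw [MvPolynomial.totalDegree_C, zero_add]
    refine (MvPolynomial.totalDegree_finsetProd _ _).trans ?_
    refine (Finset.sum_le_card_nsmul _ _ 1 fun j _ => ?_).trans (by simp)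
    refine (MvPolynomial.totalDegree_sub _ _).trans (max_le ?_
      ((MvPolynomial.totalDegree_C _).trans_le zero_le_one))
    refine (MvPolynomial.totalDegree_mul _ _).trans ?_
    rw [MvPolynomial.totalDegree_C, zero_add]
    exact (T.isHat_hat hK b).1
  have hBval : ∀ b k x, polyVal (B b k) x = binom (p * polyVal (hat b K) x) k := fun b k x => by
    simp only [hB, binom, polyVal_mul, polyVal_C, polyVal_prod, polyVal_sub]
    ring
  set node : (Pt d → ℕ) → Pt d := fun α => ∑ b ∈ K, ((α b : ℝ) / (p : ℝ)) • b with hnode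
  refine ⟨∑ β ∈ Finset.piAntidiag K p, MvPolynomial.C (polyVal w (node β)) * ∏ b ∈ K, B b (β b),
    ?_, ?_⟩
  · refine MvPolynomial.totalDegree_finsetSum_le fun β hβ => ?_
    refine (MvPolynomial.totalDegree_mul _ _).trans ?_
    rw [MvPolynomial.totalDegree_C, zero_add]
    refine (MvPolynomial.totalDegree_finsetProd _ _).trans ?_
    exact (Finset.sum_le_sum fun b _ => hBdeg b (β b)).trans
      (Finset.mem_piAntidiag.1 hβ).1.le
  · rintro x ⟨α, hα, rfl⟩
    have hsum : ∑ b ∈ K, ((α b : ℝ) / (p : ℝ)) = 1 := by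
      rw [← Finset.sum_div, div_eq_one_iff_eq hp0]
      exact_mod_cast hα
    have hval : ∀ β : Pt d → ℕ, polyVal (∏ b ∈ K, B b (β b))
        (∑ b ∈ K, ((α b : ℝ) / (p : ℝ)) • b) = ∏ b ∈ K, ((α b).choose (β b) : ℝ) := by
      intro β
      rw [polyVal_prod]
      refine Finset.prod_congr rfl fun b hb => ?_
      rw [hBval, T.polyVal_hat hK b hsum, if_pos hb, mul_div_cancel₀ _ hp0, binom_natCast]
    simp only [polyVal_sum, polyVal_mul, polyVal_C, hval]
    -- A node leaves α unspecified off K, whereas the index set requires zero there.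
    set α' : Pt d → ℕ := fun b => if b ∈ K then α b else 0 with hα'
    have hα'K : ∀ b ∈ K, α' b = α b := fun b hb => if_pos hb
    have hmem : α' ∈ Finset.piAntidiag K p := by
      rw [Finset.mem_piAntidiag]
      refine ⟨(Finset.sum_congr rfl hα'K).trans hα, fun b hb => ?_⟩
      by_contra h
      exact hb (if_neg h)
    rw [Finset.sum_eq_single_of_mem α' hmem]
    · have h1 : node α' = ∑ b ∈ K, ((α b : ℝ) / (p : ℝ)) • b :=
        Finset.sum_congr rfl fun b hb => by rw [hα'K b hb]
      rw [h1, Finset.prod_eq_one fun b hb => by rw [hα'K b hb]; simp, mul_one]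
    · intro β hβ hne
      obtain ⟨hβs, hβK⟩ := Finset.mem_piAntidiag.1 hβ
      have hlt : ∃ b ∈ K, α b < β b := by
        by_contra! hle
        refine hne (funext fun b => ?_)
        by_cases hb : b ∈ K
        · rw [hα'K b hb]
          exact (Finset.sum_eq_sum_iff_of_le hle).1 (hβs.trans hα.symm) b hb
        · rw [hα']
          simp only [if_neg hb]
          by_contra h
          exact hb (hβK b h)
      obtain ⟨b, hb, hlt⟩ := hlt
      rw [Finset.prod_eq_zero hb (by rw [Nat.choose_eq_zero_of_lt hlt]; simp), mul_zero]

lemma isLagrangeInterp_lagrangeInterp (hK : K ∈ T.elements) {p : ℕ} (hp : 1 ≤ p) (w : Poly d) :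
    IsLagrangeInterp K p w (lagrangeInterp K p w) :=
  Classical.epsilon_spec (T.exists_isLagrangeInterp hK hp w)

end SimplicialMesh

lemma lagrangeNodes_mono {σ K : Finset (Pt d)} (h : σ ⊆ K) (p : ℕ) :
    lagrangeNodes σ p ⊆ lagrangeNodes K p := by
  classical
  rintro x ⟨α, hα, rfl⟩
  refine ⟨fun b => if b ∈ σ then α b else 0, ?_, ?_⟩
  · rw [← Finset.sum_subset h fun b _ hb => if_neg hb, ← hα]
    exact Finset.sum_congr rfl fun b hb => if_pos hb
  · rw [← Finset.sum_subset h fun b _ hb => by simp [hb]]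
    exact Finset.sum_congr rfl fun b hb => by simp [hb]

/-! ### Existence of the conforming minimizer -/

/-- The `i`-th partial derivative of a polynomial, as an element of `L²` of the simplex `K`. -/
noncomputable def gradLp (K : Finset (Pt d)) (i : Fin d) :
    Poly d →ₗ[ℝ] Lp ℝ 2 (volume.restrict (openSimplex K)) where
  toFun q := (memLp_polyVal (MvPolynomial.pderiv i q) K).toLp
  map_add' q r := by
    rw [← MemLp.toLp_add]
    congr 1
    ext x
    simp [polyVal_add]
  map_smul' c q := by
    simp only [RingHom.id_apply]
    rw [← MemLp.toLp_const_smul]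
    congr 1
    ext x
    simp [polyVal_smul]

/-- The space containing the elementwise gradients. -/
abbrev GradSpace (S : Finset (Finset (Pt d))) :=
  PiLp 2 fun j : S × Fin d => Lp ℝ 2 (volume.restrict (openSimplex (j.1 : Finset (Pt d))))

/-- The elementwise gradient. -/
noncomputable def brokenGrad (S : Finset (Finset (Pt d))) :
    (Finset (Pt d) → Poly d) →ₗ[ℝ] GradSpace S :=
  (WithLp.linearEquiv 2 ℝ _).symm.toLinearMap ∘ₗ
    LinearMap.pi fun j => gradLp (j.1 : Finset (Pt d)) j.2 ∘ₗ LinearMap.proj (j.1 : Finset (Pt d))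

lemma brokenGrad_apply (S : Finset (Finset (Pt d))) (q : Finset (Pt d) → Poly d)
    (j : S × Fin d) : brokenGrad S q j = gradLp (j.1 : Finset (Pt d)) j.2 (q j.1) := rfl

lemma norm_gradLp_sq (K : Finset (Pt d)) (i : Fin d) (q : Poly d) :
    ‖gradLp K i q‖ ^ 2 = ∫ x in openSimplex K,
      polyVal (MvPolynomial.pderiv i q) x * polyVal (MvPolynomial.pderiv i q) x := by
  rw [← real_inner_self_eq_norm_sq, L2.inner_def]
  refine integral_congr_ae ?_
  filter_upwards [(memLp_polyVal (MvPolynomial.pderiv i q) K).coeFn_toLp] with x hx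
  simp only [gradLp, LinearMap.coe_mk, AddHom.coe_mk, hx]
  simp [sq]

lemma integrable_polyVal_mul (q r : Poly d) (K : Finset (Pt d)) :
    Integrable (fun x => polyVal q x * polyVal r x) (volume.restrict (openSimplex K)) :=
  (memLp_polyVal q K).integrable_mul (memLp_polyVal r K)

lemma brokenGradNorm_eq_norm (S : Finset (Finset (Pt d))) (q : Finset (Pt d) → Poly d) :
    brokenGradNorm S q = ‖brokenGrad S q‖ := by
  rw [PiLp.norm_eq_of_L2, brokenGradNorm]
  congr 1
  rw [Fintype.sum_prod_type, ← Finset.sum_coe_sort S]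
  refine Finset.sum_congr rfl fun K _ => ?_
  simp only [gradDot]
  rw [integral_finsetSum _ fun i _ => integrable_polyVal_mul _ _ _]
  exact Finset.sum_congr rfl fun i _ => (norm_gradLp_sq _ _ _).symm

lemma brokenFun_add (S : Finset (Finset (Pt d))) (q r : Finset (Pt d) → Poly d) :
    brokenFun S (q + r) = brokenFun S q + brokenFun S r := by
  ext x
  simp only [brokenFun, Pi.add_apply, ← Finset.sum_add_distrib]
  refine Finset.sum_congr rfl fun K _ => ?_
  by_cases hx : x ∈ openSimplex K <;> simp [hx, polyVal_add]

lemma brokenFun_smul (S : Finset (Finset (Pt d))) (c : ℝ) (q : Finset (Pt d) → Poly d) :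
    brokenFun S (c • q) = c • brokenFun S q := by
  ext x
  simp only [brokenFun, Pi.smul_apply, smul_eq_mul, Finset.mul_sum]
  refine Finset.sum_congr rfl fun K _ => ?_
  by_cases hx : x ∈ openSimplex K <;> simp [hx, polyVal_smul]

lemma IsConforming.zero (S : Finset (Finset (Pt d))) (p : ℕ) : IsConforming S p 0 := by
  refine ⟨fun K _ => by simp, ?_⟩
  have := brokenFun_smul S 0 (0 : Finset (Pt d) → Poly d)
  rw [zero_smul, zero_smul] at this
  rw [this]
  exact MemH10.zero _

lemma IsConforming.add {S : Finset (Finset (Pt d))} {p : ℕ} {q r : Finset (Pt d) → Poly d}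
    (hq : IsConforming S p q) (hr : IsConforming S p r) : IsConforming S p (q + r) :=
  ⟨fun K hK => (MvPolynomial.totalDegree_add _ _).trans (max_le (hq.1 K hK) (hr.1 K hK)),
    brokenFun_add S q r ▸ hq.2.add hr.2⟩

lemma IsConforming.smul {S : Finset (Finset (Pt d))} {p : ℕ} {q : Finset (Pt d) → Poly d}
    (c : ℝ) (hq : IsConforming S p q) : IsConforming S p (c • q) :=
  ⟨fun K hK => (MvPolynomial.totalDegree_smul_le _ _).trans (hq.1 K hK),
    brokenFun_smul S c q ▸ hq.2.smul c⟩

/-- The conforming piecewise polynomials. -/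
def conforming (S : Finset (Finset (Pt d))) (p : ℕ) : Submodule ℝ (Finset (Pt d) → Poly d) where
  carrier := {q | IsConforming S p q}
  add_mem' hq hr := IsConforming.add hq hr
  zero_mem' := IsConforming.zero S p
  smul_mem' c _ hq := IsConforming.smul c hq

/-- A family in `conforming` is unconstrained off S, so the finite dimension is claimed only for the
gradients, which depend on the polynomials of degree at most p on S. -/
lemma finiteDimensional_map_conforming (S : Finset (Finset (Pt d))) (p : ℕ) :
    FiniteDimensional ℝ ((conforming S p).map (brokenGrad S)) := by
  classical
  let E : (S → MvPolynomial.restrictTotalDegree (Fin d) ℝ p) →ₗ[ℝ] (Finset (Pt d) → Poly d) :=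
    LinearMap.pi fun K => if h : K ∈ S then
      (Submodule.subtype _) ∘ₗ LinearMap.proj ⟨K, h⟩ else 0
  have hle : (conforming S p).map (brokenGrad S) ≤ LinearMap.range (brokenGrad S ∘ₗ E) := by
    rintro _ ⟨q, hq, rfl⟩
    refine ⟨fun K => ⟨q K, (MvPolynomial.mem_restrictTotalDegree _ _ _).2 (hq.1 K K.2)⟩, ?_⟩
    ext1 j
    simp only [LinearMap.comp_apply, brokenGrad_apply]
    congr 1
    simp [E]
  exact Submodule.finiteDimensional_of_le hle

/-- The seminorm becomes the norm of the Hilbert space `GradSpace`, where a finite-dimensional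
subspace contains a best approximation of any target. -/
lemma exists_isConformingMin (S : Finset (Finset (Pt d))) (p : ℕ) (w : Finset (Pt d) → Poly d) :
    ∃ s, IsConformingMin S p w s := by
  have := finiteDimensional_map_conforming S p
  obtain ⟨_, ⟨s, hs, rfl⟩, hmin⟩ := Submodule.exists_norm_eq_iInf_of_complete_subspace
    ((conforming S p).map (brokenGrad S)) (Submodule.complete_of_finiteDimensional _)
    (brokenGrad S w)
  refine ⟨s, hs, fun v hv => ?_⟩
  rw [brokenGradNorm_eq_norm, brokenGradNorm_eq_norm, map_sub, map_sub, hmin]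
  exact ciInf_le (f := fun v : (conforming S p).map (brokenGrad S) => ‖brokenGrad S w - v‖)
    ⟨0, by rintro _ ⟨v, rfl⟩; exact norm_nonneg _⟩ ⟨_, v, hv, rfl⟩

/-- Piecewise polynomials whose elementwise gradient has vanishing norm are piecewise constant. -/
lemma SimplicialMesh.exists_eq_C_of_brokenGradNorm_eq_zero (T : SimplicialMesh d)
    {S : Finset (Finset (Pt d))} (hS : S ⊆ T.elements) {q : Finset (Pt d) → Poly d}
    (h : brokenGradNorm S q = 0) {K : Finset (Pt d)} (hK : K ∈ S) :
    ∃ c, q K = MvPolynomial.C c := by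
  refine eq_C_of_pderiv_eq_zero fun i => ?_
  rw [brokenGradNorm_eq_norm, norm_eq_zero] at h
  have h1 : gradLp K i (q K) = 0 := by
    have := brokenGrad_apply S q (⟨K, hK⟩, i)
    rw [h] at this
    exact this.symm
  have h2 : polyVal (MvPolynomial.pderiv i (q K)) =ᵐ[volume.restrict (openSimplex K)]
      polyVal 0 := by
    have h3 := (memLp_polyVal (MvPolynomial.pderiv i (q K)) K).coeFn_toLp
    have h4 : ⇑(gradLp K i (q K)) =ᵐ[volume.restrict (openSimplex K)] 0 := by
      rw [h1]
      exact Lp.coeFn_zero _ _ _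
    filter_upwards [h3, h4] with x h3 h4
    rw [polyVal_zero, ← h3]
    exact h4
  exact eq_of_polyVal_eq_on_open (isOpen_openSimplex K) (T.openSimplex_nonempty (hS hK))
    (Measure.eqOn_open_of_ae_eq h2 (isOpen_openSimplex K) (continuous_polyVal _).continuousOn
      (continuous_polyVal _).continuousOn)

/-! ### Open faces of the mesh -/

/-- The relative interior of the simplex with vertex set `σ`. -/
def openFace (σ : Finset (Pt d)) : Set (Pt d) :=
  {x | ∃ w : Pt d → ℝ, (∀ b ∈ σ, 0 < w b) ∧ ∑ b ∈ σ, w b = 1 ∧ ∑ b ∈ σ, w b • b = x}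

lemma openFace_subset_convexHull (σ : Finset (Pt d)) :
    openFace σ ⊆ convexHull ℝ (σ : Set (Pt d)) := by
  rintro x ⟨w, hw, hw1, hwx⟩
  exact Finset.mem_convexHull'.2 ⟨w, fun b hb => (hw b hb).le, hw1, hwx⟩

lemma exists_mem_openFace {K : Finset (Pt d)} {x : Pt d}
    (hx : x ∈ convexHull ℝ (K : Set (Pt d))) : ∃ σ ⊆ K, x ∈ openFace σ := by
  classical
  obtain ⟨w, hw, hw1, hwx⟩ := Finset.mem_convexHull'.1 hx
  refine ⟨K.filter fun b => w b ≠ 0, Finset.filter_subset _ _, w, fun b hb => ?_, ?_, ?_⟩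
  · obtain ⟨hbK, hb0⟩ := Finset.mem_filter.1 hb
    exact lt_of_le_of_ne (hw b hbK) (Ne.symm hb0)
  · rw [Finset.sum_filter_ne_zero, hw1]
  · rw [← hwx]
    refine Finset.sum_filter_of_ne fun b _ hb h => hb ?_
    rw [h, zero_smul]

lemma convexHull_subset_closure_openFace {σ : Finset (Pt d)} {x : Pt d} (hx : x ∈ openFace σ) :
    convexHull ℝ (σ : Set (Pt d)) ⊆ closure (openFace σ) := by
  intro y hy
  obtain ⟨w, hw, hw1, rfl⟩ := hx
  obtain ⟨v, hv, hv1, rfl⟩ := Finset.mem_convexHull'.1 hy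
  have hc : Continuous fun t : ℝ => ∑ b ∈ σ, ((1 - t) * v b + t * w b) • b := by fun_prop
  have ht : Tendsto (fun t : ℝ => ∑ b ∈ σ, ((1 - t) * v b + t * w b) • b) (𝓝[>] 0)
      (𝓝 (∑ b ∈ σ, v b • b)) := by
    have := (hc.tendsto 0).mono_left (nhdsWithin_le_nhds (s := Set.Ioi 0))
    simpa using this
  refine mem_closure_of_tendsto ht ?_
  filter_upwards [Ioo_mem_nhdsGT (zero_lt_one' ℝ)] with t ht
  refine ⟨fun b => (1 - t) * v b + t * w b, fun b hb => ?_, ?_, rfl⟩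
  · exact add_pos_of_nonneg_of_pos (mul_nonneg (by linarith [ht.2]) (hv b hb))
      (mul_pos ht.1 (hw b hb))
  · rw [Finset.sum_add_distrib, ← Finset.mul_sum, ← Finset.mul_sum, hv1, hw1]
    ring

lemma mem_domainOf_iff {S : Finset (Finset (Pt d))} {x : Pt d} :
    x ∈ domainOf S ↔ ∀ᶠ y in 𝓝 x, ∃ K ∈ S, y ∈ convexHull ℝ (K : Set (Pt d)) := by
  rw [domainOf, mem_interior_iff_mem_nhds, ← eventually_mem_set]
  simp

lemma eventually_mem_simplex_imp (S : Finset (Finset (Pt d))) (x : Pt d) :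
    ∀ᶠ y in 𝓝 x, ∀ K ∈ S, y ∈ convexHull ℝ (K : Set (Pt d)) →
      x ∈ convexHull ℝ (K : Set (Pt d)) := by
  refine (Filter.eventually_all_finset S).2 fun K _ => ?_
  by_cases hx : x ∈ convexHull ℝ (K : Set (Pt d))
  · exact Eventually.of_forall fun _ _ => hx
  · filter_upwards [(isClosed_simplex K).isOpen_compl.mem_nhds hx] with y hy hyK
    exact absurd hyK hy

lemma mem_convexHull_of_mem_lagrangeNodes {σ : Finset (Pt d)} {p : ℕ} (hp : 1 ≤ p) {x : Pt d}
    (hx : x ∈ lagrangeNodes σ p) : x ∈ convexHull ℝ (σ : Set (Pt d)) := by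
  have hp0 : (p : ℝ) ≠ 0 := by positivity
  obtain ⟨α, hα, rfl⟩ := hx
  refine Finset.mem_convexHull'.2 ⟨fun b => (α b : ℝ) / p, fun b _ => by positivity, ?_, rfl⟩
  rw [← Finset.sum_div, div_eq_one_iff_eq hp0]
  exact_mod_cast hα

namespace SimplicialMesh

variable (T : SimplicialMesh d) {K L σ : Finset (Pt d)}

/-- By matching, x has barycentric coordinates supported on K ∩ L. By uniqueness of coordinates in K
they agree with the positive ones on σ. -/
lemma subset_of_mem_openFace (hK : K ∈ T.elements) (hL : L ∈ T.elements) (hσ : σ ⊆ K) {x : Pt d}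
    (hx : x ∈ openFace σ) (hxL : x ∈ convexHull ℝ (L : Set (Pt d))) : σ ⊆ L := by
  classical
  have hxK : x ∈ convexHull ℝ (K : Set (Pt d)) :=
    convexHull_mono (Finset.coe_subset.2 hσ) (openFace_subset_convexHull σ hx)
  have hxKL : x ∈ convexHull ℝ ((K ∩ L : Finset (Pt d)) : Set (Pt d)) := by
    rw [Finset.coe_inter, ← T.matching K hK L hL]
    exact ⟨hxK, hxL⟩
  obtain ⟨w, hw, hw1, hwx⟩ := hx
  obtain ⟨v, -, hv1, hvx⟩ := Finset.mem_convexHull'.1 hxKL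
  have hsub : K ∩ L ⊆ K := Finset.inter_subset_left
  have key := (T.indep K hK).eq_of_sum_eq_sum_subtype
    (w₁ := fun b => if b ∈ σ then w b else 0) (w₂ := fun b => if b ∈ K ∩ L then v b else 0)
    (by
      rw [← Finset.sum_filter, ← Finset.sum_filter, Finset.filter_mem_eq_inter,
        Finset.filter_mem_eq_inter, Finset.inter_eq_right.2 hσ, Finset.inter_eq_right.2 hsub,
        hw1, hv1])
    (by
      simp only [ite_smul, zero_smul]
      rw [← Finset.sum_filter, ← Finset.sum_filter, Finset.filter_mem_eq_inter,
        Finset.filter_mem_eq_inter, Finset.inter_eq_right.2 hσ, Finset.inter_eq_right.2 hsub,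
        hwx, hvx])
  intro b hb
  have h := key b (hσ hb)
  simp only [if_pos hb] at h
  by_contra hbL
  rw [if_neg fun h' => hbL (Finset.mem_inter.1 h').2] at h
  exact (hw b hb).ne' h

/-- Open faces lie either in the domain or off the domain. -/
lemma mem_domain_of_mem_openFace (hK : K ∈ T.elements) (hσ : σ ⊆ K) {x z : Pt d}
    (hx : x ∈ openFace σ) (hz : z ∈ openFace σ) (hzT : z ∈ T.domain) : x ∈ T.domain := by
  have hz' := hz
  obtain ⟨w, hw, hw1, rfl⟩ := hx
  obtain ⟨v, hv, hv1, rfl⟩ := hz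
  set x := ∑ b ∈ σ, w b • b with hx
  set z := ∑ b ∈ σ, v b • b with hz
  obtain ⟨s, hs, hsw⟩ : ∃ s : ℝ, 0 < s ∧ ∀ b ∈ σ, 0 ≤ w b + s * (w b - v b) := by
    have : ∀ᶠ s : ℝ in 𝓝[>] 0, ∀ b ∈ σ, 0 < w b + s * (w b - v b) := by
      refine (Filter.eventually_all_finset σ).2 fun b hb => ?_
      have hc : Continuous fun s : ℝ => w b + s * (w b - v b) := by fun_prop
      have := (hc.tendsto 0).mono_left (nhdsWithin_le_nhds (s := Set.Ioi 0))
      rw [zero_mul, add_zero] at this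
      exact this.eventually_const_lt (hw b hb)
    obtain ⟨s, hs, hs0⟩ := (this.and self_mem_nhdsWithin).exists
    exact ⟨s, hs0, fun b hb => (hs b hb).le⟩
  -- The point y lies slightly beyond x as seen from z, and still in the closed face.
  set y := x + s • (x - z) with hy
  have hyσ : y ∈ convexHull ℝ (σ : Set (Pt d)) := by
    refine Finset.mem_convexHull'.2 ⟨fun b => w b + s * (w b - v b), hsw, ?_, ?_⟩
    · rw [Finset.sum_add_distrib, ← Finset.mul_sum, Finset.sum_sub_distrib, hw1, hv1]
      ring
    · simp only [add_smul, mul_smul, sub_smul, Finset.sum_add_distrib, ← Finset.smul_sum,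
        Finset.sum_sub_distrib]
      rw [hy, hx, hz]
  have hs1 : 1 + s ≠ 0 := by positivity
  -- The homothety with centre y taking x to z. If g x' is close enough to z, it lies in an element
  -- containing z, hence σ and y; by convexity that element contains x', which lies between g x' and
  -- y.
  set g : Pt d → Pt d := fun x' => z + ((1 + s) / s) • (x' - x) with hg
  have hgc : Continuous g := by fun_prop
  have hgx : g x = z := by simp [hg]
  have hgy : ∀ x', x' = (s / (1 + s)) • g x' + (1 / (1 + s)) • y := by
    intro x'
    have e1 : s / (1 + s) * ((1 + s) / s) = 1 := by field_simp
    have e2 : (1 / (1 + s)) • y = x - (s / (1 + s)) • z := by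
      have : y = (1 + s) • x - s • z := by rw [hy]; module
      rw [this, smul_sub, smul_smul, smul_smul, one_div, inv_mul_cancel₀ hs1, one_smul]
      congr 2
      ring
    rw [e2, hg]
    simp only [smul_add, smul_smul, e1, one_smul]
    abel
  rw [SimplicialMesh.domain, mem_domainOf_iff] at hzT ⊢
  have h1 := hzT.and (eventually_mem_simplex_imp T.elements z)
  rw [← hgx] at h1
  filter_upwards [(hgc.tendsto x).eventually h1] with x' hx'
  obtain ⟨⟨L, hL, hx'L⟩, himp⟩ := hx'
  rw [hgx] at himp
  have hzL := himp L hL hx'L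
  have hσL := T.subset_of_mem_openFace hK hL hσ hz' hzL
  refine ⟨L, hL, ?_⟩
  rw [hgy x']
  exact convex_convexHull ℝ _ hx'L (convexHull_mono (Finset.coe_subset.2 hσL) hyσ)
    (by positivity) (by positivity) (by field_simp; ring)

/-- The vertex patch as a mesh. -/
noncomputable def patchMesh (a : Pt d) : SimplicialMesh d where
  elements := T.patch a
  card_eq K hK := T.card_eq K (Finset.filter_subset _ _ hK)
  indep K hK := T.indep K (Finset.filter_subset _ _ hK)
  matching K hK L hL :=
    T.matching K (Finset.filter_subset _ _ hK) L (Finset.filter_subset _ _ hL)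

lemma mem_patch {a : Pt d} : K ∈ T.patch a ↔ K ∈ T.elements ∧ a ∈ K := by
  simp [patch]

lemma patch_subset (a : Pt d) : T.patch a ⊆ T.elements := Finset.filter_subset _ _

/-- Elements that meet a small neighbourhood of x contain x, hence all of σ, hence a: near x the
patch and the whole mesh cover the same points. -/
lemma mem_domainOf_patch (hK : K ∈ T.elements) (hσ : σ ⊆ K) {a x : Pt d} (ha : a ∈ σ)
    (hx : x ∈ openFace σ) (hxT : x ∈ T.domain) : x ∈ domainOf (T.patch a) := by
  rw [SimplicialMesh.domain, mem_domainOf_iff] at hxT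
  rw [mem_domainOf_iff]
  filter_upwards [hxT, eventually_mem_simplex_imp T.elements x] with y hy hyx
  obtain ⟨L, hL, hyL⟩ := hy
  exact ⟨L, T.mem_patch.2 ⟨hL, T.subset_of_mem_openFace hK hL hσ hx (hyx L hL hyL) ha⟩, hyL⟩

lemma domainOf_patch_subset (a : Pt d) : domainOf (T.patch a) ⊆ T.domain :=
  interior_mono (Set.biUnion_subset_biUnion_left (T.patch_subset a))

/-! ### The interpolated hat-weighted function is conforming -/

open Classical in
lemma polyVal_hat_of_subset (hK : K ∈ T.elements) (hσ : σ ⊆ K) (a : Pt d) {w : Pt d → ℝ}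
    (hw : ∑ b ∈ σ, w b = 1) :
    polyVal (hat a K) (∑ b ∈ σ, w b • b) = if a ∈ σ then w a else 0 := by
  obtain ⟨h1, h2⟩ := T.isHat_hat hK a
  rw [polyVal_sum_smul_of_totalDegree_le_one h1 hw,
    Finset.sum_congr rfl fun b hb => by rw [h2 b (hσ hb)]]
  simp

lemma sum_lagrangeNode {p : ℕ} (hp : 1 ≤ p) {α : Pt d → ℕ} (hα : ∑ b ∈ σ, α b = p) :
    ∑ b ∈ σ, ((α b : ℝ) / (p : ℝ)) = 1 := by
  have hp0 : (p : ℝ) ≠ 0 := by positivity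
  rw [← Finset.sum_div, div_eq_one_iff_eq hp0]
  exact_mod_cast hα

/-- Through the Lipschitz representative f, conformity reduces to two pointwise facts: agreement on
common faces (`hcons`) and vanishing off the patch domain (`hzero`). Each follows from nodal values
on a single face. -/
lemma isConforming_lagrangeInterp_hat_mul {p : ℕ} (hp : 1 ≤ p) {q : Finset (Pt d) → Poly d}
    (hq : MemH10 T.domain (brokenFun T.elements q)) (a : Pt d) :
    IsConforming (T.patch a) p (fun K => lagrangeInterp K p (hat a K * q K)) := by
  classical
  obtain ⟨C, f, hfl, hf, hf0⟩ := T.exists_lipschitz_of_memH10 hq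
  set W : Finset (Pt d) → Poly d := fun K => lagrangeInterp K p (hat a K * q K) with hW
  have hWI : ∀ K ∈ T.elements, IsLagrangeInterp K p (hat a K * q K) (W K) := fun K hK =>
    T.isLagrangeInterp_lagrangeInterp hK hp _
  refine ⟨fun K hK => (hWI K (T.patch_subset a hK)).1, ?_⟩
  have hcons : ∀ K ∈ T.elements, ∀ L ∈ T.elements, ∀ x ∈ convexHull ℝ (K : Set (Pt d)),
      x ∈ convexHull ℝ (L : Set (Pt d)) → polyVal (W K) x = polyVal (W L) x := by
    intro K hK L hL x hxK hxL
    have hx : x ∈ convexHull ℝ ((K ∩ L : Finset (Pt d)) : Set (Pt d)) := by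
      rw [Finset.coe_inter, ← T.matching K hK L hL]
      exact ⟨hxK, hxL⟩
    have hsK : K ∩ L ⊆ K := Finset.inter_subset_left
    have hsL : K ∩ L ⊆ L := Finset.inter_subset_right
    obtain ⟨w, -, hw1, rfl⟩ := Finset.mem_convexHull'.1 hx
    rw [← sub_eq_zero, ← polyVal_sub]
    refine polyVal_eq_zero_of_lagrangeNodes hp ((MvPolynomial.totalDegree_sub _ _).trans
      (max_le (hWI K hK).1 (hWI L hL).1)) (fun z hz => ?_) hw1
    have hzc := mem_convexHull_of_mem_lagrangeNodes hp hz
    rw [polyVal_sub, (hWI K hK).2 z (lagrangeNodes_mono hsK p hz),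
      (hWI L hL).2 z (lagrangeNodes_mono hsL p hz), polyVal_mul, polyVal_mul,
      ← hf K hK z (convexHull_mono (Finset.coe_subset.2 hsK) hzc),
      ← hf L hL z (convexHull_mono (Finset.coe_subset.2 hsL) hzc)]
    obtain ⟨α, hα, rfl⟩ := hz
    rw [T.polyVal_hat_of_subset hK hsK a (sum_lagrangeNode hp hα),
      T.polyVal_hat_of_subset hL hsL a (sum_lagrangeNode hp hα), sub_self]
  have hzero : ∀ K ∈ T.patch a, ∀ x ∈ convexHull ℝ (K : Set (Pt d)), x ∉ domainOf (T.patch a) →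
      polyVal (W K) x = 0 := by
    intro K hKa x hxK hx
    have hK := T.patch_subset a hKa
    obtain ⟨σ, hσ, hxσ⟩ := exists_mem_openFace hxK
    obtain ⟨w, -, hw1, hwx⟩ := id hxσ
    rw [← hwx]
    refine polyVal_eq_zero_of_lagrangeNodes hp (hWI K hK).1 (fun z hz => ?_) hw1
    rw [(hWI K hK).2 z (lagrangeNodes_mono hσ p hz), polyVal_mul]
    by_cases ha : a ∈ σ
    -- Around such a face the patch fills the mesh, so a point off the patch domain is off the whole
    -- domain, and f vanishes on the entire closed face.
    · have hxT : x ∉ T.domain := fun h => hx (T.mem_domainOf_patch hK hσ ha hxσ h)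
      have hfσ : ∀ y ∈ openFace σ, f y = 0 := fun y hy =>
        hf0 y fun h => hxT (T.mem_domain_of_mem_openFace hK hσ hxσ hy h)
      have hcl : closure (openFace σ) ⊆ {y | f y = 0} :=
        closure_minimal hfσ (isClosed_eq hfl.continuous continuous_const)
      have hzc := mem_convexHull_of_mem_lagrangeNodes hp hz
      have hfz : f z = 0 := hcl (convexHull_subset_closure_openFace hxσ hzc)
      rw [← hf K hK z (convexHull_mono (Finset.coe_subset.2 hσ) hzc), hfz, mul_zero]
    · obtain ⟨α, hα, rfl⟩ := hz
      rw [T.polyVal_hat_of_subset hK hσ a (sum_lagrangeNode hp hα), if_neg ha, zero_mul]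
  -- The single-valued function takes the polynomial of any patch element containing x; `hcons`
  -- makes the choice immaterial.
  refine (T.patchMesh a).memH10_of_eq_polyVal (f := fun x =>
    if h : ∃ K ∈ T.patch a, x ∈ convexHull ℝ (K : Set (Pt d)) then polyVal (W h.choose) x else 0)
    (fun K hK x hx => ?_) fun x hx => ?_
  · have h : ∃ K ∈ T.patch a, x ∈ convexHull ℝ (K : Set (Pt d)) := ⟨K, hK, hx⟩
    simp only [dif_pos h]
    exact hcons _ (T.patch_subset a h.choose_spec.1) K (T.patch_subset a hK) x
      h.choose_spec.2 hx
  · by_cases h : ∃ K ∈ T.patch a, x ∈ convexHull ℝ (K : Set (Pt d))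
    · simp only [dif_pos h]
      exact hzero _ h.choose_spec.1 x h.choose_spec.2 hx
    · simp only [dif_neg h]

/-! ### The projection property -/

lemma isConformingMin_reconstruction (p : ℕ) (a : Pt d) (q : Finset (Pt d) → Poly d) :
    IsConformingMin (T.patch a) p (fun K => lagrangeInterp K p (hat a K * q K))
      (reconstruction T p a q) :=
  Classical.epsilon_spec (exists_isConformingMin _ _ _)

/-- A conforming function with vanishing elementwise gradient vanishes. -/
lemma eq_zero_of_brokenGradNorm_eq_zero (hd : 1 ≤ d) {q : Finset (Pt d) → Poly d}
    (hq : MemH10 T.domain (brokenFun T.elements q)) (h : brokenGradNorm T.elements q = 0)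
    (hK : K ∈ T.elements) : q K = 0 := by
  obtain ⟨C, f, -, hf, hf0⟩ := T.exists_lipschitz_of_memH10 hq
  have hlip : LipschitzWith 0 f := by
    refine T.lipschitz_of_eq_polyVal hf hf0 fun L hL => ?_
    obtain ⟨c, hc⟩ := T.exists_eq_C_of_brokenGradNorm_eq_zero (Finset.Subset.refl _) h hL
    intro x _ y _
    simp [hc, polyVal_C]
  have : Nonempty (Fin d) := ⟨⟨0, hd⟩⟩
  -- In dimension at least one the bounded domain is not the whole space. The globally constant f
  -- takes the value zero at an outside point.
  obtain ⟨x₀, hx₀⟩ : ∃ x₀, x₀ ∉ T.domain := by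
    by_contra! hall
    refine NormedSpace.unbounded_univ ℝ (Pt d) ((isBounded_domainOf T.elements).subset ?_)
    exact fun x _ => hall x
  refine eq_of_polyVal_eq_on_open (isOpen_openSimplex K) (T.openSimplex_nonempty hK)
    fun x hx => ?_
  have h1 := hlip.dist_le_mul x x₀
  rw [NNReal.coe_zero, zero_mul, hf0 x₀ hx₀] at h1
  rw [polyVal_zero, ← hf K hK x (openSimplex_subset K hx)]
  exact dist_le_zero.1 h1

/-- The target is itself admissible, so the minimal distance is zero; the difference of target and
minimiser is conforming with zero gradient. -/
lemma reconstruction_eq (hd : 1 ≤ d) {p : ℕ} (hp : 1 ≤ p) {q : Finset (Pt d) → Poly d}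
    (hq : MemH10 T.domain (brokenFun T.elements q)) {a : Pt d} (hK : K ∈ T.patch a) :
    reconstruction T p a q K = lagrangeInterp K p (hat a K * q K) := by
  obtain ⟨hs, hmin⟩ := T.isConformingMin_reconstruction p a q
  have hw := T.isConforming_lagrangeInterp_hat_mul hp hq a
  set w : Finset (Pt d) → Poly d := fun K => lagrangeInterp K p (hat a K * q K)
  set s := reconstruction T p a q
  have hsub : IsConforming (T.patch a) p (w - s) := by
    have := hw.add (hs.smul (-1))
    rwa [neg_one_smul, ← sub_eq_add_neg] at this
  have h0 : brokenGradNorm (T.patch a) (w - s) = 0 := by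
    refine le_antisymm ((hmin w hw).trans (le_of_eq ?_)) (Real.sqrt_nonneg _)
    rw [sub_self, brokenGradNorm_eq_norm, map_zero, norm_zero]
  have := (T.patchMesh a).eq_zero_of_brokenGradNorm_eq_zero hd hsub.2 h0 hK
  exact (sub_eq_zero.1 this).symm

/-- The interpolated hat-weighted contributions of the vertices of an element add up. -/
lemma sum_lagrangeInterp_hat_mul (hK : K ∈ T.elements) {p : ℕ} (hp : 1 ≤ p) {q : Poly d}
    (hq : q.totalDegree ≤ p) : ∑ a ∈ K, lagrangeInterp K p (hat a K * q) = q := by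
  have hI := fun a => T.isLagrangeInterp_lagrangeInterp hK hp (hat a K * q)
  refine eq_of_polyVal_eq_on_open (isOpen_openSimplex K) (T.openSimplex_nonempty hK)
    fun x hx => ?_
  obtain ⟨w, -, hw1, rfl⟩ := Finset.mem_convexHull'.1 (openSimplex_subset K hx)
  rw [← sub_eq_zero, ← polyVal_sub]
  refine polyVal_eq_zero_of_lagrangeNodes hp ((MvPolynomial.totalDegree_sub _ _).trans
    (max_le (MvPolynomial.totalDegree_finsetSum_le fun a _ => (hI a).1) hq)) (fun z hz => ?_) hw1
  rw [polyVal_sub, polyVal_sum, Finset.sum_congr rfl fun a _ => (hI a).2 z hz]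
  simp only [polyVal_mul]
  rw [← Finset.sum_mul]
  obtain ⟨α, hα, rfl⟩ := hz
  have h1 := sum_lagrangeNode hp hα
  rw [Finset.sum_congr rfl fun a ha => by rw [T.polyVal_hat hK a h1, if_pos ha], h1, one_mul,
    sub_self]

/-! ### The local projection reproduces polynomials -/

lemma integrable_gradDot (q r : Poly d) (K : Finset (Pt d)) :
    Integrable (gradDot q r) (volume.restrict (openSimplex K)) :=
  integrable_finsetSum _ fun _ _ => integrable_polyVal_mul _ _ _

lemma gradDot_sub_left (q r s : Poly d) (x : Pt d) :
    gradDot (q - r) s x = gradDot q s x - gradDot r s x := by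
  simp [gradDot, polyVal_sub, sub_mul]

lemma localBest_eq (hK : K ∈ T.elements) {p : ℕ} {u : Pt d → ℝ} {q : Poly d}
    (hq : q.totalDegree ≤ p) (hu : u =ᵐ[volume.restrict (openSimplex K)] polyVal q) :
    localBest p u K = q := by
  have hex : IsLocalBest K p u q :=
    ⟨hq, (integral_congr_ae hu).symm, _, hasH1Grad_of_ae_eq_polyVal hu, fun r _ => rfl⟩
  obtain ⟨hr, hmean, G, hG, hgrad⟩ : IsLocalBest K p u (localBest p u K) :=
    Classical.epsilon_spec ⟨q, hex⟩
  set r := localBest p u K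
  have hGq := ae_eq_pderiv_of_weakGradient (isOpen_openSimplex K) hG.2.1 hG.2.2 hu
  have hgrad' : ∀ s : Poly d, s.totalDegree ≤ p →
      ∫ x in openSimplex K, gradDot r s x = ∫ x in openSimplex K, gradDot q s x := by
    intro s hs
    rw [hgrad s hs]
    refine integral_congr_ae ?_
    filter_upwards [eventually_all.2 hGq] with x hx
    simp only [gradDot, hx]
  -- Testing with r - q itself, on the one-element collection {K}.
  have h0 : brokenGradNorm {K} (fun _ => r - q) = 0 := by
    rw [brokenGradNorm, Finset.sum_singleton]
    simp only [gradDot_sub_left]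
    rw [integral_sub (integrable_gradDot _ _ _) (integrable_gradDot _ _ _), hgrad' _
      ((MvPolynomial.totalDegree_sub _ _).trans (max_le hr hq)), sub_self, Real.sqrt_zero]
  obtain ⟨c, hc⟩ := T.exists_eq_C_of_brokenGradNorm_eq_zero (S := {K}) (by simpa using hK) h0
    (Finset.mem_singleton_self K)
  have hint : ∀ s : Poly d, Integrable (polyVal s) (volume.restrict (openSimplex K)) := fun s =>
    (memLp_polyVal s K).integrable (by norm_num)
  have hc0 : ∫ x in openSimplex K, polyVal (r - q) x = 0 := by
    simp only [polyVal_sub]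
    rw [integral_sub (hint r) (hint q), hmean, integral_congr_ae hu, sub_self]
  simp only [hc, polyVal_C] at hc0
  rw [setIntegral_const, smul_eq_mul, mul_eq_zero] at hc0
  have hvol : volume.real (openSimplex K) ≠ 0 :=
    (ENNReal.toReal_pos ((isOpen_openSimplex K).measure_pos volume
      (T.openSimplex_nonempty hK)).ne' (isBounded_openSimplex K).measure_lt_top.ne).ne'
  rw [hc0.resolve_left hvol, map_zero] at hc
  exact sub_eq_zero.1 hc

/-! ### Assembly of the quasi-interpolant -/

/-- On an element, the quasi-interpolant is the sum of the contributions of its vertices. -/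
lemma quasiInterp_eq (hK : K ∈ T.elements) (p : ℕ) (u : Pt d → ℝ) {x : Pt d}
    (hx : x ∈ openSimplex K) : quasiInterp T p u x =
      polyVal (∑ a ∈ K, reconstruction T p a (localBest p u) K) x := by
  classical
  have hsub : K ⊆ T.vertices := fun a ha => by
    simp only [vertices, Finset.mem_biUnion, id]
    exact ⟨K, hK, ha⟩
  rw [quasiInterp, polyVal_sum, ← Finset.sum_subset hsub fun a _ ha => ?_]
  · exact Finset.sum_congr rfl fun a ha =>
      T.brokenFun_eq (T.patch_subset a) (T.mem_patch.2 ⟨hK, ha⟩) _ hx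
  · refine brokenFun_eq_zero _ fun L hL hxL => ha ?_
    rw [T.eq_of_mem_openSimplex hK (T.patch_subset a hL) hx hxL]
    exact (T.mem_patch.1 hL).2

lemma memFE_quasiInterp (p : ℕ) (u : Pt d → ℝ) : MemFE T.elements p (quasiInterp T p u) := by
  have hconf := fun a => (T.isConformingMin_reconstruction p a (localBest p u)).1
  refine ⟨fun K hK => ⟨∑ a ∈ K, reconstruction T p a (localBest p u) K,
    MvPolynomial.totalDegree_finsetSum_le fun a ha =>
      (hconf a).1 K (T.mem_patch.2 ⟨hK, ha⟩), ?_⟩, ?_⟩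
  · rw [EventuallyEq, ae_restrict_iff' (isOpen_openSimplex K).measurableSet]
    exact Eventually.of_forall fun x hx => T.quasiInterp_eq hK p u hx
  · have : quasiInterp T p u =
        ∑ a ∈ T.vertices, brokenFun (T.patch a) (reconstruction T p a (localBest p u)) := by
      ext x
      simp [quasiInterp]
    rw [this]
    refine MemH10.sum _ fun a _ => (hconf a).2.extend (isOpen_domainOf _).measurableSet
      (T.domainOf_patch_subset a) fun x hx => brokenFun_eq_zero _ fun K hK hxK =>
        hx (openSimplex_subset_domainOf hK hxK)

lemma quasiInterp_ae_eq (hd : 1 ≤ d) {p : ℕ} (hp : 1 ≤ p) {u : Pt d → ℝ}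
    (hu : MemBroken T.elements p u) (hu' : MemH10 T.domain u) :
    quasiInterp T p u =ᵐ[volume.restrict T.domain] u := by
  have hbest : ∀ K ∈ T.elements, (localBest p u K).totalDegree ≤ p ∧
      u =ᵐ[volume.restrict (openSimplex K)] polyVal (localBest p u K) := by
    intro K hK
    obtain ⟨q, hq, huq⟩ := hu K hK
    rw [T.localBest_eq hK hq huq]
    exact ⟨hq, huq⟩
  have hae : ∀ᵐ x, ∀ K ∈ T.elements, x ∈ openSimplex K → u x = polyVal (localBest p u K) x :=
    (ae_ball_iff T.elements.countable_toSet).2 fun K hK => by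
      rw [← ae_restrict_iff' (isOpen_openSimplex K).measurableSet]
      exact (hbest K hK).2
  -- Boundaries of simplices are null sets, so u may be replaced by the broken polynomial built from
  -- its local projections.
  have hmem : MemH10 T.domain (brokenFun T.elements (localBest p u)) := by
    refine hu'.congr ?_
    rw [EventuallyEq, SimplicialMesh.domain, ae_restrict_iff' (isOpen_domainOf _).measurableSet]
    filter_upwards [ae_mem_openSimplex T.elements, hae] with x hx hux hxT
    obtain ⟨K, hK, hxK⟩ := exists_mem_simplex_of_mem_domainOf hxT
    rw [hux K hK (hx K hK hxK), T.brokenFun_eq (Finset.Subset.refl _) hK _ (hx K hK hxK)]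
  rw [EventuallyEq, SimplicialMesh.domain, ae_restrict_iff' (isOpen_domainOf _).measurableSet]
  filter_upwards [ae_mem_openSimplex T.elements, hae] with x hx hux hxT
  obtain ⟨K, hK, hxK⟩ := exists_mem_simplex_of_mem_domainOf hxT
  have hxo := hx K hK hxK
  rw [hux K hK hxo, T.quasiInterp_eq hK p u hxo, Finset.sum_congr rfl fun a ha =>
    T.reconstruction_eq hd hp hmem (T.mem_patch.2 ⟨hK, ha⟩),
    T.sum_lagrangeInterp_hat_mul hK hp (hbest K hK).1]

end SimplicialMesh

end ProjFE

theorem theorem4p3 (d p : ℕ) (hd : 1 ≤ d) (hp : 1 ≤ p) (T : ProjFE.SimplicialMesh d) :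
    (∀ u : ProjFE.Pt d → ℝ, ProjFE.MemH10 T.domain u →
      ProjFE.MemFE T.elements p (ProjFE.quasiInterp T p u)) ∧
    (∀ u : ProjFE.Pt d → ℝ, ProjFE.MemBroken T.elements p u → ProjFE.MemH10 T.domain u →
      ProjFE.quasiInterp T p u =ᵐ[volume.restrict T.domain] u) :=
  ⟨fun u _ => T.memFE_quasiInterp p u, fun _ hu hu' => T.quasiInterp_ae_eq hd hp hu hu'⟩
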